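/- **Setting.** Let $\mathcal S^N$ be the space of real symmetric $N\times N$ matrices. For measurable $U:\mathbb R^N\to\mathbb R$ let $Z[A,U]=\int_{\mathbb R^N}e^{-\frac12x^TAx-U(x)}\,dx\in[0,\infty]$ and $\operatorname{dom}\Omega[\cdot,U]=\{A\in\mathcal S^N: Z[A,U]<\infty\}$. $U$ satisfies the *weak growth condition* if there is a constant $C_U$ with $U(x)+C_U(1+\|x\|^2)\ge 0$ for all $x$ and $\operatorname{dom}\Omega[\cdot,U]$ is open in $\mathcal S^N$. For symmetric positive definite $G\in\mathbb R^{N\times N}$ put $$\mathcal F[G,U]=\sup_{\mu}\Big[H(\mu)-\int U\,d\mu\Big],\qquad \Phi[G,U]=2\mathcal F[G,U]-\operatorname{Tr}\log G-N\log(2\pi e),$$ where $\mu$ runs over the Borel probability measures on $\mathbb R^N$ with finite second moments and $\int xx^T\,d\mu=G$, and $H(\mu)=-\int\log\frac{d\mu}{dx}\,d\mu$ if $\mu$ is absolutely continuous with respect to Lebesgue measure, $H(\mu)=-\infty$ otherwise. The self-energy is the matrix $\Sigma[G,U]=\frac12\nabla\Phi[G,U]$, with $\nabla_{ij}\Phi[G,U]=\frac{d}{d\delta}\big|_{\delta=0}\Phi[G+\delta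 E^{(ij)},U]$ and $E^{(ij)}_{kl}=\delta_{ik}\delta_{jl}+\delta_{il}\delta_{jk}$. **Proposition.** Let $U:\mathbb R^N\to\mathbb R$ be continuous, satisfy the weak growth condition, and satisfy $|U(x)|\le Be^{C\|x\|}$ for all $x$, for some constants $B,C>0$. Fix a symmetric positive definite $G$, and write $\Phi_G(\varepsilon)=\Phi[G,\varepsilon U]$ and $\Sigma_G(\varepsilon)=\Sigma[G,\varepsilon U]$ for $\varepsilon>0$. Then: 1. $\mathcal F[G,\varepsilon U]$ is finite for every $\varepsilon>0$. There is $\tau>0$ such that $\Sigma_G(\varepsilon)$ exists for all $\varepsilon\in(0,\tau)$ and $\Phi_G$, $\Sigma_G$ are $C^\infty$ on $(0,\tau)$. Moreover, for every $\varepsilon_0>0$ for which $\varepsilon_0U$ satisfies the weak growth condition, $\Sigma_G(\varepsilon_0)$ exists and $\Phi_G$, $\Sigma_G$ are $C^\infty$ at $\varepsilon_0$. (So they are $C^\infty$ on $(0,\infty)$ if $\varepsilon U$ satisfies the weak growth condition for every $\varepsilon>0$.) 2. All derivatives of $\Phi_G$ and $\Sigma_G$ extend continuously to $\varepsilon=0$: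 for every integer $k\ge 0$ the limits $$\Phi_G^{(k)}:=\frac1{k!}\lim_{\varepsilon\to0^+}\frac{d^k\Phi_G}{d\varepsilon^k}(\varepsilon),\qquad \Sigma_G^{(k)}:=\frac1{k!}\lim_{\varepsilon\to0^+}\frac{d^k\Sigma_G}{d\varepsilon^k}(\varepsilon)$$ exist and are finite. 3. For every integer $M\ge0$, as $\varepsilon\to0^+$, $$\Phi_G(\varepsilon)-\sum_{k=1}^M\Phi_G^{(k)}\varepsilon^k=O(\varepsilon^{M+1}),\qquad \Sigma_G(\varepsilon)-\sum_{k=1}^M\Sigma_G^{(k)}\varepsilon^k=O(\varepsilon^{M+1}).$$ -/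

import Mathlib

open MeasureTheory Filter Topology Asymptotics
open scoped ENNReal ContDiff Nat Matrix

noncomputable section

namespace GibbsLW

/-- The state space `ℝ^N`, with its Euclidean norm and Lebesgue measure. -/
abbrev State (N : ℕ) := EuclideanSpace ℝ (Fin N)

/-- The space `𝒮^N` of real symmetric `N × N` matrices, with the topology induced from all matrices. -/
abbrev SymMat (N : ℕ) := {A : Matrix (Fin N) (Fin N) ℝ // A.IsSymm}

/-- The quadratic form `xᵀ A x`. -/
def quadForm {N : ℕ} (A : Matrix (Fin N) (Fin N) ℝ) (x : State N) : ℝ :=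
  x.ofLp ⬝ᵥ (A *ᵥ x.ofLp)

/-- The partition function `Z[A,U] = ∫ exp(-½ xᵀAx - U(x)) dx`, with values in `[0,∞]`. -/
def partitionFn {N : ℕ} (A : Matrix (Fin N) (Fin N) ℝ) (U : State N → ℝ) : ℝ≥0∞ :=
  ∫⁻ x : State N, ENNReal.ofReal (Real.exp (-(1 / 2) * quadForm A x - U x))

/-- The effective domain `dom Ω[·,U] = {A ∈ 𝒮^N : Z[A,U] < ∞}` of the free energy
`Ω[A,U] = -log Z[A,U]`. -/
def domOmega {N : ℕ} (U : State N → ℝ) : Set (SymMat N) :=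
  {A | partitionFn A.1 U < ⊤}

/-- The weak growth condition: `U` is measurable, `U(x) + C (1 + ‖x‖²) ≥ 0` for some constant `C`,
and `dom Ω[·,U]` is open in `𝒮^N`. -/
structure WeakGrowth {N : ℕ} (U : State N → ℝ) : Prop where
  measurable : Measurable U
  lower_bound : ∃ C : ℝ, ∀ x, 0 ≤ U x + C * (1 + ‖x‖ ^ 2)
  isOpen_dom : IsOpen (domOmega U)

/-- At-most-exponential growth: `|U(x)| ≤ B exp(C ‖x‖)` for some constants `B, C > 0`. -/
def AtMostExpGrowth {N : ℕ} (U : State N → ℝ) : Prop :=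
  ∃ B C : ℝ, 0 < B ∧ 0 < C ∧ ∀ x, |U x| ≤ B * Real.exp (C * ‖x‖)

/-- The extended Lebesgue integral `∫ f⁺ dμ - ∫ f⁻ dμ ∈ [-∞,∞]` of a real function. It is the
usual one as soon as one of the two terms is finite. -/
def extIntegral {N : ℕ} (f : State N → ℝ) (μ : Measure (State N)) : EReal :=
  ((∫⁻ x, ENNReal.ofReal (f x) ∂μ : ℝ≥0∞) : EReal)
    - ((∫⁻ x, ENNReal.ofReal (-f x) ∂μ : ℝ≥0∞) : EReal)

open Classical in
/-- The differential entropy `H(μ) = -∫ log (dμ/dλ) dμ` if `μ ≪ λ`, and `-∞` otherwise, where `λ` is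
Lebesgue measure. For probability measures with finite second moments the positive part of the
integrand is integrable. -/
def entropy {N : ℕ} (μ : Measure (State N)) : EReal :=
  if μ ≪ volume then
    extIntegral (fun x => -Real.log ((μ.rnDeriv volume x).toReal)) μ
  else ⊥

/-- `𝒢⁻¹(G)`: the Borel probability measures `μ` on `ℝ^N` with finite second moments and
`∫ x xᵀ dμ = G`. -/
def momentFiber {N : ℕ} (G : Matrix (Fin N) (Fin N) ℝ) : Set (Measure (State N)) :=
  {μ | IsProbabilityMeasure μ ∧ Integrable (fun x : State N => ‖x‖ ^ 2) μ ∧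
    ∀ i j, ∫ x, x i * x j ∂μ = G i j}

/-- The functional `ℱ[G,U] = sup { H(μ) - ∫ U dμ : μ ∈ 𝒢⁻¹(G) }`, with values in `[-∞,∞]`. -/
def calF {N : ℕ} (G : Matrix (Fin N) (Fin N) ℝ) (U : State N → ℝ) : EReal :=
  ⨆ μ ∈ momentFiber G, entropy μ - extIntegral U μ

/-- The Luttinger-Ward functional `Φ[G,U] = 2 ℱ[G,U] - log det G - N log (2πe)`
for positive definite `G` (where `Tr log G = log det G`) and finite `ℱ[G,U]`. -/
def luttingerWard {N : ℕ} (G : Matrix (Fin N) (Fin N) ℝ) (U : State N → ℝ) : ℝ :=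
  2 * (calF G U).toReal - Real.log G.det - N * Real.log (2 * Real.pi * Real.exp 1)

/-- The symmetric matrix `E^{(ij)}`, with entries `δ_{ik} δ_{jl} + δ_{il} δ_{jk}`. -/
def symUnit {N : ℕ} (i j : Fin N) : Matrix (Fin N) (Fin N) ℝ :=
  Matrix.single i j 1 + Matrix.single j i 1

/-- `Φ[·,U]` has a derivative at `G` in each of the directions `E^{(ij)}`, so that its gradient at
`G` is defined. -/
def HasSelfEnergy {N : ℕ} (G : Matrix (Fin N) (Fin N) ℝ) (U : State N → ℝ) : Prop :=
  ∀ i j, DifferentiableAt ℝ (fun δ : ℝ => luttingerWard (G + δ • symUnit i j) U) 0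

/-- The self-energy `Σ[G,U] = ∂Φ/∂G = ½ ∇Φ`, where
`∇_{ij} Φ = lim_{δ → 0} (Φ[G + δ E^{(ij)},U] - Φ[G,U]) / δ`. -/
def selfEnergy {N : ℕ} (G : Matrix (Fin N) (Fin N) ℝ) (U : State N → ℝ) :
    Matrix (Fin N) (Fin N) ℝ :=
  Matrix.of fun i j =>
    (1 / 2) * deriv (fun δ : ℝ => luttingerWard (G + δ • symUnit i j) U) 0

/-- `Φ_G(ε) = Φ[G, εU]`. -/
def lwPath {N : ℕ} (G : Matrix (Fin N) (Fin N) ℝ) (U : State N → ℝ) (ε : ℝ) : ℝ :=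
  luttingerWard G (ε • U)

/-- `Σ_G(ε) = Σ[G, εU]`. -/
def sePath {N : ℕ} (G : Matrix (Fin N) (Fin N) ℝ) (U : State N → ℝ) (ε : ℝ) :
    Matrix (Fin N) (Fin N) ℝ :=
  selfEnergy G (ε • U)

end GibbsLW

end

/-! On the measures with `∫ xxᵀ dμ = G` the integral of `1 + ‖x‖²` is fixed, so replacing `U` by `V
= U + C(1 + ‖x‖²) ≥ 0` changes `ℱ[G, εU]` only by an explicit polynomial in `(G, ε)`
(`calF_add_quadratic`). For `V ≥ 0` the Gibbs variational principle (`calF_eq_of_gibbs`) gives `ℱ[g,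
εV] = ⟪A, g⟫ + log Z(A, ε)` as soon as the density proportional to `exp (-⟪A, xxᵀ⟫ - εV)` has second
moments `g`. Everything reduces to solving this moment equation for `A` smoothly in `(g, ε)`.

The derivative of the moment map in `A` is minus the covariance of `xxᵀ`. It is nondegenerate
because no nonzero quadratic form is almost everywhere constant, so the inverse function theorem
continues any given solution (`DominatedFamily.exists_smooth_parameter`). Two starting solutions are
used: at `ε = 0` the Gaussian parameter `½ G⁻¹`, and at `ε₀ > 0` a minimiser of `exp ⟪A, g⟫ Z(A,
ε₀)`, which exists by coercivity and lower semicontinuity and is a critical point because the domain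
of the free energy is open (`exists_gibbs_parameter`).

At `ε = 0` the integrals may diverge for negative `ε`. The Boltzmann weight is therefore replaced by
`cutExp (ε V)`, which is unchanged for `ε ≥ 0` and has bounded derivatives of all orders.
Exponential growth of `V` against Gaussian decay then dominates all integrals, and `ℱ` agrees for `ε
≥ 0` with a function smooth on a full neighbourhood of `(G, 0)`. Differentiating that function in
`g` yields the self-energy, and Taylor's theorem yields the asymptotic series. The terms of order
zero vanish because `Φ[·, 0] = 0` on positive definite matrices. -/

noncomputable section

set_option linter.unusedSectionVars false

namespace GibbsLW

/-! ### Extended integrals and Gibbs' inequality for the entropy. -/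

section Entropy

variable {N : ℕ} {μ : Measure (State N)}

theorem extIntegral_of_integrable {f : State N → ℝ} (hf : Integrable f μ) :
    extIntegral f μ = ((∫ x, f x ∂μ : ℝ) : EReal) := by
  have h1 : ∫⁻ x, ENNReal.ofReal (f x) ∂μ ≠ ⊤ := hf.lintegral_lt_top.ne
  have h2 : ∫⁻ x, ENNReal.ofReal (-f x) ∂μ ≠ ⊤ := hf.neg.lintegral_lt_top.ne
  rw [extIntegral, integral_eq_lintegral_pos_part_sub_lintegral_neg_part hf]
  rw [← EReal.coe_ennreal_toReal h1, ← EReal.coe_ennreal_toReal h2, EReal.coe_sub]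

theorem extIntegral_eq_top_of_not_integrable {f : State N → ℝ} (hfm : AEStronglyMeasurable f μ)
    (hneg : ∫⁻ x, ENNReal.ofReal (-f x) ∂μ ≠ ⊤) (hf : ¬ Integrable f μ) :
    extIntegral f μ = ⊤ := by
  have h1 : ∫⁻ x, ENNReal.ofReal (f x) ∂μ = ⊤ := by
    by_contra h
    refine hf ⟨hfm, ?_⟩
    rw [hasFiniteIntegral_iff_norm]
    calc ∫⁻ x, ENNReal.ofReal ‖f x‖ ∂μ
        ≤ ∫⁻ x, (ENNReal.ofReal (f x) + ENNReal.ofReal (-f x)) ∂μ := by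
          refine lintegral_mono fun x => ?_
          rcases le_total 0 (f x) with h0 | h0
          · rw [Real.norm_of_nonneg h0]; exact le_self_add
          · rw [Real.norm_of_nonpos h0]; exact le_add_self
      _ = ∫⁻ x, ENNReal.ofReal (f x) ∂μ + ∫⁻ x, ENNReal.ofReal (-f x) ∂μ :=
          lintegral_add_left' hfm.aemeasurable.ennreal_ofReal _
      _ < ⊤ := by
          rw [ENNReal.add_lt_top]
          exact ⟨lt_top_iff_ne_top.2 h, lt_top_iff_ne_top.2 hneg⟩
  rw [extIntegral, h1, ← EReal.coe_ennreal_toReal hneg]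
  simp

/-- An integrable majorant makes the positive part finite, so a non-integrable `f` has extended
integral `-∞`. -/
theorem extIntegral_le_of_le_integrable {f ψ : State N → ℝ} (hfm : AEStronglyMeasurable f μ)
    (hψ : Integrable ψ μ) {K : ℝ}
    (h : ∀ᵐ x ∂μ, f x ≤ ψ x) (hK : ∫ x, ψ x ∂μ ≤ K) :
    extIntegral f μ ≤ K := by
  by_cases hf : Integrable f μ
  · rw [extIntegral_of_integrable hf]
    exact_mod_cast (integral_mono_ae hf hψ h).trans hK
  · have hpos : ∫⁻ x, ENNReal.ofReal (f x) ∂μ ≠ ⊤ := by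
      refine ne_top_of_le_ne_top hψ.lintegral_lt_top.ne (lintegral_mono_ae ?_)
      filter_upwards [h] with x hx using ENNReal.ofReal_le_ofReal hx
    have htop := extIntegral_eq_top_of_not_integrable (f := fun x => -f x) hfm.neg
      (by simpa using hpos) (fun h' => hf (by simpa using h'.neg))
    rw [extIntegral] at htop ⊢
    simp only [neg_neg] at htop
    rw [← EReal.coe_ennreal_toReal hpos] at htop ⊢
    have : ((∫⁻ x, ENNReal.ofReal (-f x) ∂μ : ℝ≥0∞) : EReal) = ⊤ := by
      by_contra hne
      have h3 : ∫⁻ x, ENNReal.ofReal (-f x) ∂μ ≠ ⊤ := by simpa using hne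
      rw [← EReal.coe_ennreal_toReal h3, ← EReal.coe_sub] at htop
      exact EReal.coe_ne_top _ htop
    rw [this]; simp

/-- Gibbs' inequality: the entropy is at most the mean of `ψ` if `exp (-ψ)` has total mass at most
one. -/
theorem entropy_le_integral [IsProbabilityMeasure μ] {ψ : State N → ℝ}
    (hψm : Measurable ψ) (hψ : Integrable ψ μ)
    (hmass : ∫⁻ x, ENNReal.ofReal (Real.exp (-ψ x)) ≤ 1) :
    entropy μ ≤ ((∫ x, ψ x ∂μ : ℝ) : EReal) := by
  rw [entropy]
  split_ifs with hac
  swap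
  · exact bot_le
  set f : State N → ℝ≥0∞ := μ.rnDeriv volume with hf
  have hfm : Measurable f := Measure.measurable_rnDeriv _ _
  have hμ : volume.withDensity f = μ := Measure.withDensity_rnDeriv_eq _ _ hac
  have hfpos : ∀ᵐ x ∂μ, 0 < f x := Measure.rnDeriv_pos hac
  have hftop : ∀ᵐ x ∂μ, f x < ⊤ := hac.ae_le (Measure.rnDeriv_lt_top _ _)
  -- The ratio of the reference density to that of `μ`. Its `μ`-mass is at most one, so integrating
  -- `log q ≤ q - 1` against `μ` gives the inequality.
  set q : State N → ℝ := fun x => Real.exp (-ψ x) / (f x).toReal with hq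
  have hqm : Measurable q := (hψm.neg.exp).div hfm.ennreal_toReal
  have hqle : ∫⁻ x, ENNReal.ofReal (q x) ∂μ ≤ 1 := by
    refine le_trans ?_ hmass
    conv_lhs => rw [← hμ]
    rw [lintegral_withDensity_eq_lintegral_mul _ hfm hqm.ennreal_ofReal]
    refine lintegral_mono_ae ?_
    filter_upwards [Measure.rnDeriv_lt_top μ volume] with x hx
    rcases eq_or_ne (f x) 0 with h0 | h0
    · simp [h0]
    · have h3 : 0 < (f x).toReal := ENNReal.toReal_pos h0 hx.ne
      have : f x = ENNReal.ofReal (f x).toReal := (ENNReal.ofReal_toReal hx.ne).symm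
      rw [Pi.mul_apply, this, ← ENNReal.ofReal_mul h3.le]
      refine ENNReal.ofReal_le_ofReal (le_of_eq ?_)
      simp only [hq]
      field_simp
  have hqnn : ∀ x, 0 ≤ q x := fun x => by positivity
  have hqi : Integrable q μ := by
    refine ⟨hqm.aestronglyMeasurable, ?_⟩
    rw [hasFiniteIntegral_iff_norm]
    refine lt_of_le_of_lt ?_ (ENNReal.one_lt_top)
    simpa [Real.norm_of_nonneg (hqnn _)] using hqle
  have hq1 : ∫ x, q x ∂μ ≤ 1 := by
    rw [integral_eq_lintegral_of_nonneg_ae (Eventually.of_forall hqnn) hqm.aestronglyMeasurable]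
    exact ENNReal.toReal_le_of_le_ofReal zero_le_one (by simpa using hqle)
  refine extIntegral_le_of_le_integrable (ψ := fun x => q x - 1 + ψ x) ?_ ?_ ?_ ?_
  · exact (Real.measurable_log.comp hfm.ennreal_toReal).neg.aestronglyMeasurable
  · exact (hqi.sub (integrable_const 1)).add hψ
  · filter_upwards [hfpos, hftop] with x h0 h1
    have h3 : 0 < (f x).toReal := ENNReal.toReal_pos h0.ne' h1.ne
    have h4 : 0 < q x := by positivity
    have h5 := Real.log_le_sub_one_of_pos h4
    have h6 : Real.log (q x) = -ψ x - Real.log (f x).toReal := by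
      simp only [hq]
      rw [Real.log_div (Real.exp_pos _).ne' h3.ne', Real.log_exp]
    linarith
  · have h1 := integral_add (f := fun x => q x - 1) (hqi.sub (integrable_const 1)) hψ
    have h2 := integral_sub hqi (integrable_const (μ := μ) (1 : ℝ))
    simp only [integral_const, probReal_univ, smul_eq_mul, mul_one] at h2
    rw [h1, h2]
    linarith

/-- The case of equality in Gibbs' inequality: here minus the logarithm of the density is `ψ`
itself. -/
theorem entropy_withDensity_exp {ψ : State N → ℝ} (hψm : Measurable ψ)
    (hψ : Integrable ψ (volume.withDensity fun x => ENNReal.ofReal (Real.exp (-ψ x)))) :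
    entropy (volume.withDensity fun x => ENNReal.ofReal (Real.exp (-ψ x))) =
      ((∫ x, ψ x ∂(volume.withDensity fun x => ENNReal.ofReal (Real.exp (-ψ x))) : ℝ) : EReal) := by
  set μ : Measure (State N) := volume.withDensity fun x => ENNReal.ofReal (Real.exp (-ψ x)) with hμ
  have hm : Measurable fun x => ENNReal.ofReal (Real.exp (-ψ x)) := hψm.neg.exp.ennreal_ofReal
  have hac : μ ≪ volume := withDensity_absolutelyContinuous _ _
  have hrn : ∀ᵐ x ∂μ, -Real.log ((μ.rnDeriv volume x).toReal) = ψ x := by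
    filter_upwards [hac.ae_le (Measure.rnDeriv_withDensity volume hm)] with x hx
    rw [hx, ENNReal.toReal_ofReal (Real.exp_pos _).le, Real.log_exp, neg_neg]
  rw [entropy, if_pos hac, extIntegral_of_integrable (hψ.congr (by filter_upwards [hrn] with x hx using hx.symm)),
    integral_congr_ae hrn]

end Entropy

/-! ### Symmetric matrices as a Euclidean space, and the statistic `xxᵀ`. -/

/-- Symmetric matrices as a Euclidean space (with the Frobenius inner product). -/
def symSubmodule (N : ℕ) : Submodule ℝ (EuclideanSpace ℝ (Fin N × Fin N)) where
  carrier := {A | ∀ i j, A (i, j) = A (j, i)}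
  add_mem' := fun ha hb i j => by simp [ha i j, hb i j]
  zero_mem' := fun i j => by simp
  smul_mem' := fun c a ha i j => by simp [ha i j]

/-- The Euclidean space of symmetric matrices. -/
def SymForm (N : ℕ) : Type := symSubmodule N

instance (N : ℕ) : NormedAddCommGroup (SymForm N) :=
  inferInstanceAs (NormedAddCommGroup (symSubmodule N))

instance (N : ℕ) : InnerProductSpace ℝ (SymForm N) :=
  inferInstanceAs (InnerProductSpace ℝ (symSubmodule N))

instance (N : ℕ) : FiniteDimensional ℝ (SymForm N) :=
  inferInstanceAs (FiniteDimensional ℝ (symSubmodule N))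

instance (N : ℕ) : MeasurableSpace (SymForm N) := borel _

instance (N : ℕ) : BorelSpace (SymForm N) := ⟨rfl⟩

section SymForm

variable {N : ℕ}

/-- The matrix of a symmetric form. -/
def SymForm.toMat (A : SymForm N) : Matrix (Fin N) (Fin N) ℝ := Matrix.of fun i j => A.1 (i, j)

/-- The symmetric part of a matrix. -/
def SymForm.ofMat (M : Matrix (Fin N) (Fin N) ℝ) : SymForm N :=
  ⟨WithLp.toLp 2 fun p => (M p.1 p.2 + M p.2 p.1) / 2, fun i j => by simp [add_comm]⟩

/-- The symmetric matrix `x xᵀ`. -/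
def outerSq (x : State N) : SymForm N :=
  ⟨WithLp.toLp 2 fun p => x p.1 * x p.2, fun i j => by simp [mul_comm]⟩

/-- The entries of a symmetric form. -/
def SymForm.entry (i j : Fin N) : SymForm N →L[ℝ] ℝ :=
  (EuclideanSpace.proj (i, j) : EuclideanSpace ℝ (Fin N × Fin N) →L[ℝ] ℝ).comp (symSubmodule N).subtypeL

@[simp] theorem SymForm.add_val (A B : SymForm N) (p : Fin N × Fin N) :
    (A + B).1 p = A.1 p + B.1 p := rfl

@[simp] theorem SymForm.smul_val (c : ℝ) (A : SymForm N) (p : Fin N × Fin N) :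
    (c • A).1 p = c * A.1 p := rfl

@[simp] theorem SymForm.zero_val (p : Fin N × Fin N) : (0 : SymForm N).1 p = 0 := rfl

@[simp] theorem SymForm.entry_apply (i j : Fin N) (A : SymForm N) :
    SymForm.entry i j A = A.1 (i, j) := rfl

@[simp] theorem SymForm.toMat_apply (A : SymForm N) (i j : Fin N) : A.toMat i j = A.1 (i, j) := rfl

@[simp] theorem outerSq_apply (x : State N) (p : Fin N × Fin N) :
    (outerSq x).1 p = x p.1 * x p.2 := rfl

@[simp] theorem SymForm.ofMat_apply (M : Matrix (Fin N) (Fin N) ℝ) (p : Fin N × Fin N) :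
    (SymForm.ofMat M).1 p = (M p.1 p.2 + M p.2 p.1) / 2 := rfl

theorem SymForm.toMat_ofMat {M : Matrix (Fin N) (Fin N) ℝ} (hM : M.IsSymm) :
    (SymForm.ofMat M).toMat = M := by
  ext i j
  simp [hM.apply i j]

theorem SymForm.toMat_isSymm (A : SymForm N) : A.toMat.IsSymm := by
  ext i j
  exact A.2 j i

theorem SymForm.ext_entry {A B : SymForm N} (h : ∀ i j, A.1 (i, j) = B.1 (i, j)) : A = B := by
  apply Subtype.ext
  ext p
  exact h p.1 p.2

theorem SymForm.toMat_add_smul (A B : SymForm N) (c : ℝ) :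
    (A + c • B).toMat = A.toMat + c • B.toMat := by
  ext i j
  simp

theorem SymForm.continuous_toMat : Continuous (SymForm.toMat : SymForm N → _) :=
  continuous_matrix fun i j => (SymForm.entry i j).continuous

theorem inner_symForm (A B : SymForm N) :
    inner ℝ A B = ∑ i, ∑ j, A.1 (i, j) * B.1 (i, j) := by
  refine (PiLp.inner_apply A.1 B.1).trans ?_
  rw [Fintype.sum_prod_type]
  simp [mul_comm]

theorem inner_outerSq (A : SymForm N) (x : State N) :
    inner ℝ A (outerSq x) = quadForm A.toMat x := by
  simp only [inner_symForm, quadForm, dotProduct, Matrix.mulVec, outerSq_apply,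
    SymForm.toMat_apply, Finset.mul_sum]
  exact Finset.sum_congr rfl fun i _ => Finset.sum_congr rfl fun j _ => by ring

theorem norm_outerSq (x : State N) : ‖outerSq x‖ = ‖x‖ ^ 2 := by
  have h : ‖outerSq x‖ ^ 2 = (‖x‖ ^ 2) ^ 2 := by
    rw [← real_inner_self_eq_norm_sq, inner_symForm, EuclideanSpace.norm_sq_eq, sq (∑ i, _),
      Finset.sum_mul_sum]
    refine Finset.sum_congr rfl fun i _ => Finset.sum_congr rfl fun j _ => ?_
    simp
    ring
  exact (pow_left_inj₀ (norm_nonneg _) (by positivity) two_ne_zero).1 h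

theorem continuous_outerSq : Continuous (outerSq : State N → SymForm N) := by
  refine Continuous.subtype_mk ?_ _
  refine (PiLp.continuous_toLp 2 _).comp ?_
  fun_prop

/-- The identity matrix as a symmetric form. -/
def SymForm.one (N : ℕ) : SymForm N := SymForm.ofMat 1

theorem inner_one_outerSq (x : State N) : inner ℝ (SymForm.one N) (outerSq x) = ‖x‖ ^ 2 := by
  rw [inner_outerSq, SymForm.one, SymForm.toMat_ofMat Matrix.isSymm_one, quadForm,
    EuclideanSpace.norm_sq_eq]
  simp [dotProduct, sq]

theorem outerSq_smul (c : ℝ) (x : State N) : outerSq (c • x) = c ^ 2 • outerSq x :=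
  SymForm.ext_entry fun i j => by simp; ring

theorem outerSq_zero : outerSq (0 : State N) = 0 :=
  SymForm.ext_entry fun i j => by simp

theorem SymForm.posDef_toMat_iff (A : SymForm N) :
    A.toMat.PosDef ↔ ∃ a, 0 < a ∧ ∀ x : State N, a * ‖x‖ ^ 2 ≤ inner ℝ A (outerSq x) := by
  constructor
  · intro hA
    have hpos : ∀ x : State N, x ≠ 0 → 0 < inner ℝ A (outerSq x) := fun x hx => by
      rw [inner_outerSq]
      simpa [quadForm] using hA.dotProduct_mulVec_pos (x := x.ofLp) (by simpa using hx)
    have hcont : Continuous fun x : State N => inner ℝ A (outerSq x) :=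
      continuous_const.inner continuous_outerSq
    -- The constant is the minimum of the form on the compact unit sphere, spread by homogeneity.
    -- The sphere is empty only when `N = 0`.
    rcases (Metric.sphere (0 : State N) 1).eq_empty_or_nonempty with he | hne
    · refine ⟨1, one_pos, fun x => ?_⟩
      have hx : x = 0 := by
        by_contra hx
        have : ‖x‖⁻¹ • x ∈ Metric.sphere (0 : State N) 1 := by
          simp [norm_smul, inv_mul_cancel₀ (norm_ne_zero_iff.2 hx)]
        simp [he] at this
      simp [hx, outerSq_zero]
    · obtain ⟨y, hy, hmin⟩ := (isCompact_sphere (0 : State N) 1).exists_isMinOn hne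
        hcont.continuousOn
      have hy0 : y ≠ 0 := by
        rintro rfl
        simp at hy
      refine ⟨_, hpos y hy0, fun x => ?_⟩
      rcases eq_or_ne x 0 with rfl | hx
      · simp [outerSq_zero]
      have hx' : 0 < ‖x‖ := norm_pos_iff.2 hx
      have hmem : ‖x‖⁻¹ • x ∈ Metric.sphere (0 : State N) 1 := by
        simp [norm_smul, inv_mul_cancel₀ hx'.ne']
      have h1 : inner ℝ A (outerSq y) ≤ inner ℝ A (outerSq (‖x‖⁻¹ • x)) := hmin hmem
      have h2 : inner ℝ A (outerSq (‖x‖⁻¹ • x)) = (‖x‖⁻¹) ^ 2 * inner ℝ A (outerSq x) := by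
        rw [outerSq_smul, real_inner_smul_right]
      rw [h2] at h1
      calc _ ≤ ((‖x‖⁻¹) ^ 2 * inner ℝ A (outerSq x)) * ‖x‖ ^ 2 := by gcongr
        _ = _ := by field_simp
  · rintro ⟨a, ha, h⟩
    refine Matrix.PosDef.of_dotProduct_mulVec_pos ?_ fun x hx => ?_
    · rw [Matrix.IsHermitian, Matrix.conjTranspose_eq_transpose_of_trivial]
      exact A.toMat_isSymm
    · have h1 := h (WithLp.toLp 2 x)
      rw [inner_outerSq] at h1
      have h2 : 0 < ‖(WithLp.toLp 2 x : State N)‖ := norm_pos_iff.2 (by simpa using hx)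
      have h3 : 0 < a * ‖(WithLp.toLp 2 x : State N)‖ ^ 2 := by positivity
      simpa [quadForm] using h3.trans_le h1

end SymForm

/-! ### The Gibbs variational principle. -/

section Gibbs

variable {N : ℕ} {μ : Measure (State N)} {g : SymForm N}

theorem integrable_outerSq (hμ : μ ∈ momentFiber g.toMat) : Integrable outerSq μ := by
  refine hμ.2.1.mono' continuous_outerSq.aestronglyMeasurable (Eventually.of_forall fun x => ?_)
  rw [norm_outerSq]

theorem integral_outerSq (hμ : μ ∈ momentFiber g.toMat) : ∫ x, outerSq x ∂μ = g := by
  refine SymForm.ext_entry fun i j => ?_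
  have := (SymForm.entry i j).integral_comp_comm (integrable_outerSq hμ)
  simp only [SymForm.entry_apply, outerSq_apply] at this
  rw [← this]
  exact hμ.2.2 i j

/-- Every natural parameter gives an upper bound for `ℱ`. -/
theorem calF_le {V : State N → ℝ} (hVm : Measurable V) (hV : ∀ x, 0 ≤ V x) (A : SymForm N)
    (hint : Integrable fun x : State N => Real.exp (-(inner ℝ A (outerSq x)) - V x)) :
    calF g.toMat V ≤ ((inner ℝ A g +
      Real.log (∫ x : State N, Real.exp (-(inner ℝ A (outerSq x)) - V x)) : ℝ) : EReal) := by
  set Z := ∫ x : State N, Real.exp (-(inner ℝ A (outerSq x)) - V x) with hZ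
  have hZpos : 0 < Z := integral_exp_pos hint
  refine iSup₂_le fun μ hμ => ?_
  have := hμ.1
  have hTm : Measurable fun x : State N => inner ℝ A (outerSq x) :=
    (continuous_const.inner continuous_outerSq).measurable
  have hTi : Integrable (fun x : State N => inner ℝ A (outerSq x)) μ :=
    (integrable_outerSq hμ).const_inner A
  by_cases hVi : Integrable V μ
  · rw [extIntegral_of_integrable hVi]
    have h1 : Integrable (fun x => inner ℝ A (outerSq x) + V x + Real.log Z) μ :=
      (hTi.add hVi).add (integrable_const _)
    -- This `ψ` is minus the logarithm of the normalised Gibbs density, so `exp (-ψ)` has mass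
    -- exactly one.
    have h := entropy_le_integral (μ := μ)
      (ψ := fun x => inner ℝ A (outerSq x) + V x + Real.log Z) (by fun_prop) h1 ?_
    · have h2 : ∫ x, (inner ℝ A (outerSq x) + V x + Real.log Z) ∂μ =
          inner ℝ A g + ∫ x, V x ∂μ + Real.log Z := by
        rw [integral_add (f := fun x => inner ℝ A (outerSq x) + V x) (hTi.add hVi)
          (integrable_const _), integral_add hTi hVi, integral_inner (integrable_outerSq hμ),
          integral_outerSq hμ]
        simp
      rw [h2] at h
      refine EReal.sub_le_of_le_add ?_
      refine h.trans (le_of_eq ?_)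
      rw [← EReal.coe_add]
      congr 1
      ring
    · have h3 : ∀ x : State N, Real.exp (-(inner ℝ A (outerSq x) + V x + Real.log Z)) =
          Real.exp (-(inner ℝ A (outerSq x)) - V x) * Z⁻¹ := fun x => by
        rw [show -(inner ℝ A (outerSq x) + V x + Real.log Z) =
          (-(inner ℝ A (outerSq x)) - V x) - Real.log Z by ring, Real.exp_sub, Real.exp_log hZpos,
          div_eq_mul_inv]
      simp_rw [h3]
      rw [← ofReal_integral_eq_lintegral_ofReal (hint.mul_const _)
        (Eventually.of_forall fun x => by positivity), integral_mul_const, ← hZ,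
        mul_inv_cancel₀ hZpos.ne']
      simp
  -- Here `∫ V dμ = ∞`, and subtracting `⊤` in `EReal` gives `⊥` whatever the entropy is.
  · rw [extIntegral_eq_top_of_not_integrable hVm.aestronglyMeasurable _ hVi]
    · simp
    · have : ∀ x, ENNReal.ofReal (-V x) = 0 := fun x => by simp [hV x]
      simp [this]

/-- The Gibbs measure with density proportional to `exp (-xᵀAx - V)`: its second moments and its
entropy. -/
theorem exists_gibbs_measure {V : State N → ℝ} (hVm : Measurable V) (A : SymForm N)
    (hint : Integrable fun x : State N => Real.exp (-(inner ℝ A (outerSq x)) - V x))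
    (hVint : Integrable fun x : State N => Real.exp (-(inner ℝ A (outerSq x)) - V x) * V x)
    (hTint : Integrable fun x : State N => Real.exp (-(inner ℝ A (outerSq x)) - V x) • outerSq x)
    (hT : ∫ x : State N, Real.exp (-(inner ℝ A (outerSq x)) - V x) • outerSq x =
      (∫ x : State N, Real.exp (-(inner ℝ A (outerSq x)) - V x)) • g) :
    ∃ μ ∈ momentFiber g.toMat,
      (∀ f : State N → ℝ, Integrable (fun x : State N =>
        Real.exp (-(inner ℝ A (outerSq x)) - V x) * f x) → Integrable f μ) ∧
      entropy μ = ((inner ℝ A g + ∫ x, V x ∂μ +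
        Real.log (∫ x : State N, Real.exp (-(inner ℝ A (outerSq x)) - V x)) : ℝ) : EReal) := by
  set Z := ∫ x : State N, Real.exp (-(inner ℝ A (outerSq x)) - V x) with hZ
  have hZpos : 0 < Z := integral_exp_pos hint
  set ψ : State N → ℝ := fun x => inner ℝ A (outerSq x) + V x + Real.log Z with hψ
  have hTm : Measurable fun x : State N => inner ℝ A (outerSq x) :=
    (continuous_const.inner continuous_outerSq).measurable
  have hψm : Measurable ψ := by fun_prop
  have h3 : ∀ x : State N, Real.exp (-ψ x) =
      Z⁻¹ * Real.exp (-(inner ℝ A (outerSq x)) - V x) := fun x => by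
    rw [show -ψ x = (-(inner ℝ A (outerSq x)) - V x) - Real.log Z by simp only [hψ]; ring,
      Real.exp_sub, Real.exp_log hZpos, div_eq_inv_mul]
  set μ : Measure (State N) := volume.withDensity fun x => ENNReal.ofReal (Real.exp (-ψ x)) with hμ
  have hdm : Measurable fun x => (Real.exp (-ψ x)).toNNReal := hψm.neg.exp.real_toNNReal
  -- Kept general in the target space, as it is needed both for real functions and for `outerSq`.
  have key : ∀ {F : Type} [NormedAddCommGroup F] [NormedSpace ℝ F] (f : State N → F),
      (Integrable (fun x => Real.exp (-(inner ℝ A (outerSq x)) - V x) • f x) → Integrable f μ) ∧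
      ∫ x, f x ∂μ = Z⁻¹ • ∫ x : State N, Real.exp (-(inner ℝ A (outerSq x)) - V x) • f x := by
    intro F _ _ f
    have h4 : ∀ x, (Real.exp (-ψ x)).toNNReal • f x =
        Z⁻¹ • (Real.exp (-(inner ℝ A (outerSq x)) - V x) • f x) := fun x => by
      rw [NNReal.smul_def, Real.coe_toNNReal _ (Real.exp_pos _).le, h3, mul_smul]
    constructor
    · intro hf
      refine (integrable_withDensity_iff_integrable_smul hdm).2 ?_
      simp_rw [h4]
      exact hf.smul _
    · refine (integral_withDensity_eq_integral_smul hdm f).trans ?_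
      simp_rw [h4]
      exact integral_smul _ _
  have hprob : IsProbabilityMeasure μ := by
    refine ⟨?_⟩
    rw [hμ, withDensity_apply _ MeasurableSet.univ, setLIntegral_univ]
    simp_rw [h3]
    rw [← ofReal_integral_eq_lintegral_ofReal (hint.const_mul _)
        (Eventually.of_forall fun x => by positivity), integral_const_mul, ← hZ,
        inv_mul_cancel₀ hZpos.ne']
    simp
  have hTμ : Integrable outerSq μ := (key _).1 hTint
  have hTμ' : ∫ x, outerSq x ∂μ = g := by
    rw [(key _).2, hT, smul_smul, inv_mul_cancel₀ hZpos.ne', one_smul]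
  have hVμ : Integrable V μ := (key _).1 hVint
  have hfib : μ ∈ momentFiber g.toMat := by
    refine ⟨hprob, ?_, fun i j => ?_⟩
    · simpa only [norm_outerSq] using hTμ.norm
    · have := (SymForm.entry i j).integral_comp_comm hTμ
      rw [hTμ'] at this
      simpa using this
  have hinn : Integrable (fun x => inner ℝ A (outerSq x)) μ := hTμ.const_inner A
  have hψi : Integrable ψ μ := (hinn.add hVμ).add (integrable_const _)
  refine ⟨μ, hfib, fun f hf => (key f).1 (by simpa only [smul_eq_mul] using hf), ?_⟩
  rw [hμ, entropy_withDensity_exp hψm hψi, ← hμ]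
  congr 1
  rw [hψ, integral_add (f := fun x => inner ℝ A (outerSq x) + V x) (hinn.add hVμ)
          (integrable_const _), integral_add hinn hVμ, integral_inner hTμ, hTμ']
  simp

/-- The Gibbs variational principle: a Gibbs measure with the right second moments attains `ℱ`. -/
theorem calF_eq_of_gibbs {V : State N → ℝ} (hVm : Measurable V) (hV : ∀ x, 0 ≤ V x)
    (A : SymForm N)
    (hint : Integrable fun x : State N => Real.exp (-(inner ℝ A (outerSq x)) - V x))
    (hVint : Integrable fun x : State N => Real.exp (-(inner ℝ A (outerSq x)) - V x) * V x)
    (hTint : Integrable fun x : State N => Real.exp (-(inner ℝ A (outerSq x)) - V x) • outerSq x)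
    (hT : ∫ x : State N, Real.exp (-(inner ℝ A (outerSq x)) - V x) • outerSq x =
      (∫ x : State N, Real.exp (-(inner ℝ A (outerSq x)) - V x)) • g) :
    calF g.toMat V = ((inner ℝ A g +
      Real.log (∫ x : State N, Real.exp (-(inner ℝ A (outerSq x)) - V x)) : ℝ) : EReal) := by
  refine le_antisymm (calF_le hVm hV A hint) ?_
  obtain ⟨μ, hμ, hi, hent⟩ := exists_gibbs_measure hVm A hint hVint hTint hT
  refine le_trans (le_of_eq ?_) (le_iSup₂ (f := fun μ _ => entropy μ - extIntegral V μ) μ hμ)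
  rw [extIntegral_of_integrable (hi V hVint), hent, ← EReal.coe_sub]
  congr 1
  ring

end Gibbs

/-! ### Smoothness of exponential-family integrals in the parameter and the coupling. -/

section TiltedIntegral

variable {X : Type} [MeasurableSpace X] {E F : Type}
  [NormedAddCommGroup E] [InnerProductSpace ℝ E]
  [NormedAddCommGroup F] [NormedSpace ℝ F]

/-- The integral of `c` against the weight `w_k(ε, x) exp (-⟪A, T x⟫)`, as a function of `(A, ε)`. -/
def tiltedIntegral (ν : Measure X) (T : X → E) (w : ℕ → ℝ → X → ℝ) (k : ℕ) (c : X → F)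
    (p : E × ℝ) : F :=
  ∫ x, (w k p.2 x * Real.exp (-inner ℝ p.1 (T x))) • c x ∂ν

/-- A sequence of weights `w_k`, each being the `ε`-derivative of the previous one, such that all
the integrals of polynomials in `T` are dominated uniformly on `O`. -/
structure DominatedFamily (ν : Measure X) (T : X → E) (w : ℕ → ℝ → X → ℝ) (O : Set (E × ℝ)) :
    Prop where
  isOpen : IsOpen O
  stat_meas : AEStronglyMeasurable T ν
  weight_meas : ∀ k ε, AEStronglyMeasurable (w k ε) ν
  hasDerivAt : ∀ k x ε, HasDerivAt (fun e => w k e x) (w (k + 1) ε x) ε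
  dominated : ∀ k m : ℕ, ∃ b : X → ℝ, Integrable b ν ∧ ∀ p ∈ O, ∀ x,
    (1 + ‖T x‖) ^ m * |w k p.2 x| * Real.exp (-inner ℝ p.1 (T x)) ≤ b x

/-- At most polynomial growth in the statistic `T`. -/
def PolyGrowth (ν : Measure X) (T : X → E) (c : X → F) : Prop :=
  AEStronglyMeasurable c ν ∧ ∃ (K : ℝ) (m : ℕ), ∀ x, ‖c x‖ ≤ K * (1 + ‖T x‖) ^ m

variable {ν : Measure X} {T : X → E} {w : ℕ → ℝ → X → ℝ} {O : Set (E × ℝ)}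

theorem polyGrowth_const (c : F) : PolyGrowth ν T fun _ => c :=
  ⟨aestronglyMeasurable_const, ‖c‖, 0, fun x => by simp⟩

theorem DominatedFamily.polyGrowth_stat (h : DominatedFamily ν T w O) : PolyGrowth ν T T :=
  ⟨h.stat_meas, 1, 1, fun x => by simp⟩

namespace DominatedFamily

theorem exists_bound (h : DominatedFamily ν T w O) {c : X → F} (hc : PolyGrowth ν T c) (k : ℕ) :
    ∃ b : X → ℝ, Integrable b ν ∧ ∀ p ∈ O, ∀ x,
      ‖(w k p.2 x * Real.exp (-inner ℝ p.1 (T x))) • c x‖ ≤ b x := by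
  obtain ⟨_, K, m, hK⟩ := hc
  obtain ⟨b, hb, hbd⟩ := h.dominated k m
  refine ⟨fun x => |K| * b x, hb.const_mul _, fun p hp x => ?_⟩
  rw [norm_smul, norm_mul, Real.norm_eq_abs, Real.norm_of_nonneg (Real.exp_pos _).le]
  calc |w k p.2 x| * Real.exp (-inner ℝ p.1 (T x)) * ‖c x‖
      ≤ |w k p.2 x| * Real.exp (-inner ℝ p.1 (T x)) * (|K| * (1 + ‖T x‖) ^ m) := by
        gcongr
        exact (hK x).trans (by gcongr; exact le_abs_self K)
    _ = |K| * ((1 + ‖T x‖) ^ m * |w k p.2 x| * Real.exp (-inner ℝ p.1 (T x))) := by ring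
    _ ≤ |K| * b x := by gcongr; exact hbd p hp x

theorem aestronglyMeasurable_weight (h : DominatedFamily ν T w O) (k : ℕ) (p : E × ℝ) :
    AEStronglyMeasurable (fun x => w k p.2 x * Real.exp (-inner ℝ p.1 (T x))) ν := by
  refine (h.weight_meas k p.2).mul ?_
  exact Real.continuous_exp.comp_aestronglyMeasurable (h.stat_meas.const_inner).neg

theorem integrable (h : DominatedFamily ν T w O) {c : X → F} (hc : PolyGrowth ν T c) (k : ℕ)
    {p : E × ℝ} (hp : p ∈ O) :
    Integrable (fun x => (w k p.2 x * Real.exp (-inner ℝ p.1 (T x))) • c x) ν := by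
  obtain ⟨b, hb, hbd⟩ := h.exists_bound hc k
  exact hb.mono' ((h.aestronglyMeasurable_weight k p).smul hc.1)
    (Eventually.of_forall fun x => hbd p hp x)

/-- The part of the derivative in the direction of the natural parameter. -/
def statCoeff (T : X → E) (c : X → F) (x : X) : E × ℝ →L[ℝ] F :=
  ContinuousLinearMap.smulRightL ℝ (E × ℝ) F
    (-((innerSL ℝ (T x)).comp (ContinuousLinearMap.fst ℝ E ℝ))) (c x)

/-- The part of the derivative in the direction of the coupling. -/
def couplingCoeff (c : X → F) (x : X) : E × ℝ →L[ℝ] F :=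
  ContinuousLinearMap.smulRightL ℝ (E × ℝ) F (ContinuousLinearMap.snd ℝ E ℝ) (c x)

@[simp] theorem statCoeff_apply (c : X → F) (x : X) (q : E × ℝ) :
    statCoeff T c x q = -(inner ℝ (T x) q.1 • c x) := by
  simp [statCoeff]

@[simp] theorem couplingCoeff_apply (c : X → F) (x : X) (q : E × ℝ) :
    (couplingCoeff c x : E × ℝ →L[ℝ] F) q = q.2 • c x := by
  simp [couplingCoeff]

theorem polyGrowth_couplingCoeff {c : X → F} (hc : PolyGrowth ν T c) :
    PolyGrowth ν T (couplingCoeff c : X → (E × ℝ →L[ℝ] F)) := by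
  obtain ⟨hm, K, m, hK⟩ := hc
  refine ⟨(ContinuousLinearMap.continuous _).comp_aestronglyMeasurable hm, K, m, fun x => ?_⟩
  refine (ContinuousLinearMap.opNorm_le_bound _ (norm_nonneg _) fun q => ?_).trans (hK x)
  rw [couplingCoeff_apply, norm_smul, mul_comm]
  gcongr
  exact norm_snd_le q

theorem polyGrowth_statCoeff (h : AEStronglyMeasurable T ν) {c : X → F} (hc : PolyGrowth ν T c) :
    PolyGrowth ν T (statCoeff T c) := by
  obtain ⟨hm, K, m, hK⟩ := hc
  refine ⟨?_, K, m + 1, fun x => ?_⟩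
  · refine ContinuousLinearMap.aestronglyMeasurable_comp₂ _ ?_ hm
    refine AEStronglyMeasurable.neg ?_
    exact ((ContinuousLinearMap.compL ℝ (E × ℝ) E ℝ).flip
      (ContinuousLinearMap.fst ℝ E ℝ)).continuous.comp_aestronglyMeasurable
      ((innerSL ℝ).continuous.comp_aestronglyMeasurable h)
  · refine (ContinuousLinearMap.opNorm_le_bound _ (M := ‖T x‖ * ‖c x‖) (by positivity)
      fun q => ?_).trans ?_
    · rw [statCoeff_apply, norm_neg, norm_smul]
      calc _ ≤ ‖T x‖ * ‖q.1‖ * ‖c x‖ := by gcongr; exact norm_inner_le_norm _ _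
        _ ≤ ‖T x‖ * ‖q‖ * ‖c x‖ := by gcongr; exact norm_fst_le q
        _ = _ := by ring
    · calc _ ≤ (1 + ‖T x‖) * (K * (1 + ‖T x‖) ^ m) := by
            gcongr
            · linarith
            · exact hK x
        _ = _ := by ring

/-- The parameter direction brings down a factor `-T`, and the coupling direction raises the weight
index by one. Both terms are tilted integrals again, with coefficients of polynomial growth in a
space of linear maps, so the class is closed under differentiation. -/
theorem hasFDerivAt (h : DominatedFamily ν T w O) {c : X → F} (hc : PolyGrowth ν T c) (k : ℕ)
    {p : E × ℝ} (hp : p ∈ O) :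
    HasFDerivAt (tiltedIntegral ν T w k c)
      (tiltedIntegral ν T w k (statCoeff T c) p +
        tiltedIntegral ν T w (k + 1) (couplingCoeff c : X → (E × ℝ →L[ℝ] F)) p) p := by
  have h1 := polyGrowth_statCoeff h.stat_meas hc
  have h2 : PolyGrowth ν T (couplingCoeff c : X → (E × ℝ →L[ℝ] F)) := polyGrowth_couplingCoeff hc
  obtain ⟨b1, hb1, hbd1⟩ := h.exists_bound h1 k
  obtain ⟨b2, hb2, hbd2⟩ := h.exists_bound h2 (k + 1)
  have i1 := h.integrable h1 k hp
  have i2 := h.integrable h2 (k + 1) hp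
  have key := hasFDerivAt_integral_of_dominated_of_fderiv_le (𝕜 := ℝ) (μ := ν) (s := O) (x₀ := p)
    (F := fun p x => (w k p.2 x * Real.exp (-inner ℝ p.1 (T x))) • c x)
    (F' := fun p x => (w k p.2 x * Real.exp (-inner ℝ p.1 (T x))) • statCoeff T c x +
      (w (k + 1) p.2 x * Real.exp (-inner ℝ p.1 (T x))) • couplingCoeff c x)
    (bound := fun x => b1 x + b2 x) (h.isOpen.mem_nhds hp)
    (Eventually.of_forall fun q => (h.aestronglyMeasurable_weight k q).smul hc.1)
    (h.integrable hc k hp) (i1.add i2).aestronglyMeasurable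
    (Eventually.of_forall fun x q hq => (norm_add_le _ _).trans
      (add_le_add (hbd1 q hq x) (hbd2 q hq x)))
    (hb1.add hb2) (Eventually.of_forall fun x q _ => ?_)
  · rw [integral_add i1 i2] at key
    exact key
  · have d1 : HasFDerivAt (fun q : E × ℝ => w k q.2 x)
        (w (k + 1) q.2 x • ContinuousLinearMap.snd ℝ E ℝ) q :=
      (h.hasDerivAt k x q.2).comp_hasFDerivAt q hasFDerivAt_snd
    have d2 : HasFDerivAt (fun q : E × ℝ => -inner ℝ q.1 (T x))
        (-((innerSL ℝ (T x)).comp (ContinuousLinearMap.fst ℝ E ℝ))) q := by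
      have := ((innerSL ℝ (T x)).comp (ContinuousLinearMap.fst ℝ E ℝ)).hasFDerivAt (x := q)
      refine (this.neg).congr_of_eventuallyEq (Eventually.of_forall fun r => ?_)
      simp [real_inner_comm]
    refine ((d1.mul d2.exp).smul_const (c x)).congr_fderiv ?_
    ext r <;> simp [smul_smul, mul_comm, mul_left_comm]

theorem contDiffOn (h : DominatedFamily ν T w O) {c : X → F} (hc : PolyGrowth ν T c) (k : ℕ) :
    ContDiffOn ℝ ∞ (tiltedIntegral ν T w k c) O := by
  rw [contDiffOn_infty]
  intro n
  -- The target space changes at each differentiation, so the induction must range over all `F`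
  -- along with the coefficient and the weight index.
  induction n generalizing F k with
  | zero =>
    exact contDiffOn_zero.2 fun p hp => (h.hasFDerivAt hc k hp).continuousAt.continuousWithinAt
  | succ n ih =>
    rw [Nat.cast_add, Nat.cast_one, contDiffOn_succ_iff_fderiv_of_isOpen h.isOpen]
    refine ⟨fun p hp => (h.hasFDerivAt hc k hp).differentiableAt.differentiableWithinAt,
      by simp, ?_⟩
    refine ContDiffOn.congr ((ih (polyGrowth_statCoeff h.stat_meas hc) k).add
      (ih (polyGrowth_couplingCoeff hc) (k + 1))) fun p hp => (h.hasFDerivAt hc k hp).fderiv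

end DominatedFamily

end TiltedIntegral

/-! ### Local inversion of the moment map. -/

/-- The inverse function theorem, with a local inverse that is smooth on an open set. -/
theorem exists_contDiffOn_local_inverse {P : Type*} [NormedAddCommGroup P] [NormedSpace ℝ P]
    [FiniteDimensional ℝ P] {f : P → P} {O : Set P} (hO : IsOpen O) (hf : ContDiffOn ℝ ∞ f O)
    {p₀ : P} (hp₀ : p₀ ∈ O) (hinj : Function.Injective (fderiv ℝ f p₀)) :
    ∃ W : Set P, IsOpen W ∧ f p₀ ∈ W ∧ ∃ s : P → P, ContDiffOn ℝ ∞ s W ∧ s (f p₀) = p₀ ∧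
      ∀ q ∈ W, s q ∈ O ∧ f (s q) = q := by
  have : CompleteSpace P := FiniteDimensional.complete ℝ P
  have hinf : (∞ : WithTop ℕ∞) ≠ 0 := by simp
  have hdiff : ∀ p ∈ O, ContDiffAt ℝ ∞ f p := fun p hp => hf.contDiffAt (hO.mem_nhds hp)
  set e' : P ≃L[ℝ] P :=
    (LinearEquiv.ofInjectiveEndo (fderiv ℝ f p₀ : P →ₗ[ℝ] P) hinj).toContinuousLinearEquiv
    with he'
  have he'f : (e' : P →L[ℝ] P) = fderiv ℝ f p₀ := by
    ext x
    simp [he']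
  have hstrict : HasStrictFDerivAt f (e' : P →L[ℝ] P) p₀ := by
    rw [he'f]
    exact (hdiff p₀ hp₀).hasStrictFDerivAt hinf
  set Φ := hstrict.toOpenPartialHomeomorph f with hΦ
  -- Invertible linear maps form an open set. Restricting to points with invertible derivative makes
  -- the inverse smooth on a whole neighbourhood, not only at `f p₀`.
  set O' : Set P := O ∩ (fderiv ℝ f) ⁻¹' (Set.range ((↑) : (P ≃L[ℝ] P) → P →L[ℝ] P)) with hO'
  have hO'open : IsOpen O' :=
    (hf.continuousOn_fderiv_of_isOpen hO (by simp)).isOpen_inter_preimage hO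
      ContinuousLinearEquiv.isOpen
  have hsrc : p₀ ∈ Φ.source := hstrict.mem_toOpenPartialHomeomorph_source
  have hsymm : Φ.symm (f p₀) = p₀ := Φ.left_inv hsrc
  refine ⟨Φ.target ∩ Φ.symm ⁻¹' O', Φ.symm.isOpen_inter_preimage hO'open, ⟨?_, ?_⟩, Φ.symm,
    ?_, hsymm, ?_⟩
  · exact hstrict.image_mem_toOpenPartialHomeomorph_target
  · rw [Set.mem_preimage, hsymm]
    exact ⟨hp₀, e', he'f⟩
  · rintro q ⟨hq, hqO, e, he⟩
    refine (Φ.contDiffAt_symm (f₀' := e) hq ?_ (hdiff _ hqO)).contDiffWithinAt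
    rw [he]
    exact ((hdiff _ hqO).differentiableAt hinf).hasFDerivAt
  · rintro q ⟨hq, hqO, -⟩
    exact ⟨hqO, Φ.right_inv hq⟩

/-! ### Solving the moment equation of an exponential family. -/

section Conjugate

variable {X : Type} [MeasurableSpace X] {E F : Type}
  [NormedAddCommGroup E] [InnerProductSpace ℝ E]
  [NormedAddCommGroup F] [NormedSpace ℝ F] [CompleteSpace F]
  {ν : Measure X} {T : X → E} {w : ℕ → ℝ → X → ℝ} {O : Set (E × ℝ)}

theorem DominatedFamily.fderiv_apply_stat (h : DominatedFamily ν T w O) {c : X → F}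
    (hc : PolyGrowth ν T c) (k : ℕ) {p : E × ℝ} (hp : p ∈ O) (a : E) :
    fderiv ℝ (tiltedIntegral ν T w k c) p (a, 0) =
      -∫ x, (w k p.2 x * Real.exp (-inner ℝ p.1 (T x)) * inner ℝ a (T x)) • c x ∂ν := by
  rw [(h.hasFDerivAt hc k hp).fderiv, add_apply, tiltedIntegral, tiltedIntegral,
    ContinuousLinearMap.integral_apply (h.integrable (polyGrowth_statCoeff h.stat_meas hc) k hp),
    ContinuousLinearMap.integral_apply (h.integrable (polyGrowth_couplingCoeff hc) (k + 1) hp),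
    ← integral_neg]
  simp [smul_smul, real_inner_comm]

/-- Local solution of the moment equation of an exponential family, depending smoothly on the
prescribed moment and on the coupling. -/
theorem DominatedFamily.exists_smooth_parameter [FiniteDimensional ℝ E] [NeZero ν]
    (h : DominatedFamily ν T w O) {p₀ : E × ℝ} (hp₀ : p₀ ∈ O) (hpos : ∀ x, 0 < w 0 p₀.2 x)
    (hnd : ∀ (a : E) (m : ℝ), (∀ᵐ x ∂ν, inner ℝ a (T x) = m) → a = 0) {g₀ : E}
    (hg₀ : tiltedIntegral ν T w 0 T p₀ = tiltedIntegral ν T w 0 (fun _ => (1 : ℝ)) p₀ • g₀) :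
    ∃ W : Set (E × ℝ), IsOpen W ∧ (g₀, p₀.2) ∈ W ∧ ∃ S : E × ℝ → E, ContDiffOn ℝ ∞ S W ∧
      S (g₀, p₀.2) = p₀.1 ∧ ∀ q ∈ W, (S q, q.2) ∈ O ∧
        0 < tiltedIntegral ν T w 0 (fun _ => (1 : ℝ)) (S q, q.2) ∧
        tiltedIntegral ν T w 0 T (S q, q.2) =
          tiltedIntegral ν T w 0 (fun _ => (1 : ℝ)) (S q, q.2) • q.1 := by
  set Z := tiltedIntegral ν T w 0 (fun _ => (1 : ℝ)) with hZdef
  set J := tiltedIntegral ν T w 0 T with hJdef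
  have hc1 : PolyGrowth ν T fun _ => (1 : ℝ) := polyGrowth_const _
  have hcT : PolyGrowth ν T T := h.polyGrowth_stat
  have hZs : ContDiffOn ℝ ∞ Z O := h.contDiffOn hc1 0
  have hJs : ContDiffOn ℝ ∞ J O := h.contDiffOn hcT 0
  set ρ : X → ℝ := fun x => w 0 p₀.2 x * Real.exp (-inner ℝ p₀.1 (T x)) with hρ
  have hρpos : ∀ x, 0 < ρ x := fun x => mul_pos (hpos x) (Real.exp_pos _)
  have hρi : Integrable ρ ν := by simpa using h.integrable hc1 0 hp₀
  have hZρ : Z p₀ = ∫ x, ρ x ∂ν := by simp [hZdef, tiltedIntegral, hρ]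
  have hJρ : J p₀ = ∫ x, ρ x • T x ∂ν := rfl
  have hZ0 : 0 < Z p₀ := by
    rw [hZρ, integral_pos_iff_support_of_nonneg (fun x => (hρpos x).le) hρi]
    have : Function.support ρ = Set.univ := Set.eq_univ_of_forall fun x => (hρpos x).ne'
    rw [this]
    exact Measure.measure_univ_pos.2 (NeZero.ne ν)
  set O' : Set (E × ℝ) := O ∩ Z ⁻¹' Set.Ioi 0 with hO'
  have hO'open : IsOpen O' := hZs.continuousOn.isOpen_inter_preimage h.isOpen isOpen_Ioi
  set M : E × ℝ → E := fun p => (Z p)⁻¹ • J p with hM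
  have hMs : ContDiffOn ℝ ∞ M O' :=
    ((hZs.mono Set.inter_subset_left).inv fun p hp => (ne_of_gt hp.2)).smul
      (hJs.mono Set.inter_subset_left)
  -- Carrying the coupling along as a second coordinate turns the implicit function problem into one
  -- of local inversion.
  set f : E × ℝ → E × ℝ := fun p => (M p, p.2) with hf
  have hfs : ContDiffOn ℝ ∞ f O' := hMs.prodMk contDiff_snd.contDiffOn
  have hp₀' : p₀ ∈ O' := ⟨hp₀, hZ0⟩
  have hMg : M p₀ = g₀ := by
    simp only [hM]
    rw [hg₀, smul_smul, inv_mul_cancel₀ hZ0.ne', one_smul]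
  have hinf : (∞ : WithTop ℕ∞) ≠ 0 := by simp
  have hMd : DifferentiableAt ℝ M p₀ :=
    (hMs.contDiffAt (hO'open.mem_nhds hp₀')).differentiableAt hinf
  have hZd : DifferentiableAt ℝ Z p₀ :=
    (hZs.contDiffAt (h.isOpen.mem_nhds hp₀)).differentiableAt hinf
  -- A kernel vector has no coupling component. Its component `a` gives `⟪a, T⟫` zero variance under
  -- the weight `ρ`, hence makes it almost everywhere constant, and `hnd` forces `a = 0`.
  have hinj : Function.Injective (fderiv ℝ f p₀) := by
    rw [injective_iff_map_eq_zero]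
    rintro ⟨a, e⟩ hae
    have hfd : fderiv ℝ f p₀ = (fderiv ℝ M p₀).prod (ContinuousLinearMap.snd ℝ E ℝ) :=
      (hMd.hasFDerivAt.prodMk hasFDerivAt_snd).fderiv
    rw [hfd] at hae
    simp only [ContinuousLinearMap.prod_apply, Prod.mk_eq_zero] at hae
    obtain ⟨hae, he⟩ := hae
    simp only [ContinuousLinearMap.coe_snd'] at he
    subst he
    have hJM : J =ᶠ[𝓝 p₀] fun p => Z p • M p := by
      filter_upwards [hO'open.mem_nhds hp₀'] with p hp
      simp only [hM]
      rw [smul_smul, mul_inv_cancel₀ (ne_of_gt hp.2), one_smul]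
    -- Differentiating `J = Z • M` and using `dM(a, 0) = 0` avoids the quotient rule. The identity
    -- says that the covariance of `⟪a, T⟫` with `T` vanishes.
    have hJd : fderiv ℝ J p₀ (a, 0) = fderiv ℝ Z p₀ (a, 0) • g₀ := by
      rw [hJM.fderiv_eq, fderiv_fun_smul hZd hMd]
      simp [hae, hMg]
    rw [h.fderiv_apply_stat hcT 0 hp₀, h.fderiv_apply_stat hc1 0 hp₀] at hJd
    simp only [smul_eq_mul, mul_one, neg_smul, neg_inj] at hJd
    set m := inner ℝ a g₀ with hm
    have hTi : Integrable (fun x => ρ x • T x) ν := h.integrable hcT 0 hp₀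
    have i1 : Integrable (fun x => ρ x * inner ℝ a (T x)) ν := by
      simpa [inner_smul_right] using hTi.const_inner (𝕜 := ℝ) a
    have i2' : Integrable (fun x => (ρ x * inner ℝ a (T x)) • T x) ν := by
      have := h.integrable (polyGrowth_statCoeff h.stat_meas hcT) 0 hp₀
      have := (this.apply_continuousLinearMap (a, 0)).neg
      refine this.congr (Eventually.of_forall fun x => ?_)
      simp [hρ, smul_smul, real_inner_comm]
    have i2 : Integrable (fun x => ρ x * inner ℝ a (T x) ^ 2) ν := by
      refine (i2'.const_inner (𝕜 := ℝ) a).congr (Eventually.of_forall fun x => ?_)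
      simp [inner_smul_right]
      ring
    have e1 : ∫ x, ρ x * inner ℝ a (T x) ∂ν = Z p₀ * m := by
      have := integral_inner (𝕜 := ℝ) hTi a
      simp only [inner_smul_right] at this
      rw [this, ← hJρ, hg₀, inner_smul_right]
    have e2 : ∫ x, ρ x * inner ℝ a (T x) ^ 2 ∂ν = Z p₀ * m * m := by
      have h1 := integral_inner (𝕜 := ℝ) i2' a
      rw [hJd, inner_smul_right, e1] at h1
      rw [← hm] at h1
      rw [← h1]
      refine integral_congr_ae (Eventually.of_forall fun x => ?_)
      simp [inner_smul_right]
      ring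
    have hvar : ∫ x, ρ x * (inner ℝ a (T x) - m) ^ 2 ∂ν = 0 := by
      have : ∀ x, ρ x * (inner ℝ a (T x) - m) ^ 2 =
          ρ x * inner ℝ a (T x) ^ 2 - 2 * m * (ρ x * inner ℝ a (T x)) + m ^ 2 * ρ x :=
        fun x => by ring
      simp_rw [this]
      rw [integral_add (f := fun x => ρ x * inner ℝ a (T x) ^ 2 - 2 * m * (ρ x * inner ℝ a (T x)))
        (i2.sub (i1.const_mul _)) (hρi.const_mul _), integral_sub i2 (i1.const_mul _),
        integral_const_mul, integral_const_mul, e1, e2, ← hZρ]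
      ring
    have hvi : Integrable (fun x => ρ x * (inner ℝ a (T x) - m) ^ 2) ν := by
      refine ((i2.sub (i1.const_mul (2 * m))).add (hρi.const_mul (m ^ 2))).congr
        (Eventually.of_forall fun x => ?_)
      simp
      ring
    rw [integral_eq_zero_iff_of_nonneg (fun x => mul_nonneg (hρpos x).le (sq_nonneg _)) hvi] at hvar
    have ha : a = 0 := hnd a m <| by
      filter_upwards [hvar] with x hx
      have := (mul_eq_zero.1 hx).resolve_left (hρpos x).ne'
      exact sub_eq_zero.1 (pow_eq_zero_iff two_ne_zero |>.1 this)
    rw [ha]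
    rfl
  obtain ⟨W, hW, hfW, s, hs, hs0, hsW⟩ := exists_contDiffOn_local_inverse hO'open hfs hp₀' hinj
  have hfp : f p₀ = (g₀, p₀.2) := by simp [hf, hMg]
  rw [hfp] at hfW hs0
  refine ⟨W, hW, hfW, fun q => (s q).1, contDiff_fst.comp_contDiffOn hs, by simp [hs0],
    fun q hq => ?_⟩
  obtain ⟨hsO, hfs⟩ := hsW q hq
  have h2 : (s q).2 = q.2 := (Prod.ext_iff.1 hfs).2
  have h1 : M (s q) = q.1 := (Prod.ext_iff.1 hfs).1
  have h3 : ((s q).1, q.2) = s q := by rw [← h2]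
  simp only [h3]
  refine ⟨hsO.1, hsO.2, ?_⟩
  rw [← h1]
  simp only [hM]
  rw [smul_smul, mul_inv_cancel₀ (ne_of_gt hsO.2), one_smul]

end Conjugate

/-! ### A cut-off exponential that allows negative couplings. -/

section Cutoff

/-- A smooth function with bounded derivatives which agrees with `exp (-s)` for `s ≥ -1`. -/
def cutExp (s : ℝ) : ℝ := Real.exp (-s) * Real.smoothTransition (s + 2)

theorem contDiff_cutExp : ContDiff ℝ ∞ cutExp :=
  (Real.contDiff_exp.comp contDiff_neg).mul
    (Real.smoothTransition.contDiff.comp (contDiff_id.add contDiff_const))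

theorem iteratedDeriv_exp_neg (k : ℕ) (s : ℝ) :
    iteratedDeriv k (fun t : ℝ => Real.exp (-t)) s = (-1) ^ k * Real.exp (-s) := by
  rw [iteratedDeriv_comp_neg k Real.exp]
  simp [iteratedDeriv_eq_iterate]

theorem iteratedDeriv_cutExp_of_nonneg (k : ℕ) {s : ℝ} (hs : 0 ≤ s) :
    iteratedDeriv k cutExp s = (-1) ^ k * Real.exp (-s) := by
  rw [← iteratedDeriv_exp_neg]
  refine Filter.EventuallyEq.iteratedDeriv_eq k ?_
  filter_upwards [lt_mem_nhds (show (-1 : ℝ) < s by linarith)] with t ht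
  rw [cutExp, Real.smoothTransition.one_of_one_le (by linarith), mul_one]

theorem iteratedDeriv_cutExp_of_lt (k : ℕ) {s : ℝ} (hs : s < -2) :
    iteratedDeriv k cutExp s = 0 := by
  have : cutExp =ᶠ[𝓝 s] fun _ => 0 := by
    filter_upwards [gt_mem_nhds hs] with t ht
    rw [cutExp, Real.smoothTransition.zero_of_nonpos (by linarith), mul_zero]
  rw [this.iteratedDeriv_eq k]
  simp

/-- The derivative vanishes below `-2`, is continuous on the compact interval `[-2, 0]`, and is `±
exp (-s)` beyond it. -/
theorem exists_bound_iteratedDeriv_cutExp (k : ℕ) :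
    ∃ M : ℝ, 0 ≤ M ∧ ∀ s, |iteratedDeriv k cutExp s| ≤ M := by
  obtain ⟨M, hM⟩ := (isCompact_Icc (a := (-2 : ℝ)) (b := 0)).exists_bound_of_continuousOn
    (contDiff_cutExp.continuous_iteratedDeriv k (by exact_mod_cast le_top)).continuousOn
  refine ⟨max M 1, le_max_of_le_right zero_le_one, fun s => ?_⟩
  rcases lt_or_ge s (-2) with h | h
  · rw [iteratedDeriv_cutExp_of_lt k h]
    simp
  rcases le_or_gt s 0 with h0 | h0
  · exact (hM s ⟨h, h0⟩).trans (le_max_left _ _)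
  · rw [iteratedDeriv_cutExp_of_nonneg k h0.le]
    refine le_trans ?_ (le_max_right _ _)
    rw [abs_mul, abs_pow, abs_neg, abs_one, one_pow, one_mul, abs_of_pos (Real.exp_pos _)]
    exact Real.exp_le_one_iff.2 (by linarith)

end Cutoff

/-! ### Boltzmann weights and their domination. -/

section Weight

variable {N : ℕ} {V : State N → ℝ}

/-- The `k`-th derivative in `ε` of the Boltzmann weight `exp (-εV)`, continued smoothly to negative
couplings. -/
def weight (V : State N → ℝ) (k : ℕ) (ε : ℝ) (x : State N) : ℝ :=
  V x ^ k * iteratedDeriv k cutExp (ε * V x)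

theorem hasDerivAt_weight (k : ℕ) (x : State N) (ε : ℝ) :
    HasDerivAt (fun e => weight V k e x) (weight V (k + 1) ε x) ε := by
  have h1 : HasDerivAt (iteratedDeriv k cutExp) (iteratedDeriv (k + 1) cutExp (ε * V x))
      (ε * V x) := by
    rw [iteratedDeriv_succ]
    exact ((contDiff_cutExp.differentiable_iteratedDeriv k
      (by exact_mod_cast WithTop.coe_lt_top _)) _).hasDerivAt
  have h2 := (h1.comp ε ((hasDerivAt_id ε).mul_const (V x))).const_mul (V x ^ k)
  refine h2.congr_deriv ?_
  simp only [weight]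
  ring

theorem measurable_weight (hV : Measurable V) (k : ℕ) (ε : ℝ) : Measurable (weight V k ε) :=
  (hV.pow_const k).mul ((contDiff_cutExp.continuous_iteratedDeriv k
    (by exact_mod_cast le_top)).measurable.comp (hV.const_mul ε))

theorem weight_of_nonneg (hV : ∀ x, 0 ≤ V x) (k : ℕ) {ε : ℝ} (hε : 0 ≤ ε) (x : State N) :
    weight V k ε x = (-1) ^ k * (V x ^ k * Real.exp (-(ε * V x))) := by
  rw [weight, iteratedDeriv_cutExp_of_nonneg k (mul_nonneg hε (hV x))]
  ring

theorem weight_zero_of_nonneg (hV : ∀ x, 0 ≤ V x) {ε : ℝ} (hε : 0 ≤ ε) (x : State N) :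
    weight V 0 ε x = Real.exp (-(ε * V x)) := by
  simp [weight_of_nonneg hV 0 hε]

theorem integrable_exp_neg_mul_norm_sq {b : ℝ} (hb : 0 < b) :
    Integrable fun x : State N => Real.exp (-b * ‖x‖ ^ 2) := by
  -- A Bochner integral that is not zero certifies integrability, so the closed Gaussian formula
  -- suffices.
  refine Integrable.of_integral_ne_zero ?_
  rw [GaussianFourier.integral_rexp_neg_mul_sq_norm hb]
  positivity

theorem integrable_poly_mul_exp {b : ℝ} (hb : 0 < b) (c : ℝ) (m : ℕ) :
    Integrable fun x : State N =>
      (1 + ‖x‖ ^ 2) ^ m * Real.exp (c * ‖x‖) * Real.exp (-b * ‖x‖ ^ 2) := by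
  -- The polynomial costs `m * δ ≤ b / 4` of the Gaussian rate, and `exp (c * ‖x‖)` costs another `b
  -- / 4` after completing the square. A rate `b / 2` remains. The bound `δ ≤ 1` serves `1 + r² ≤
  -- δ⁻¹ (1 + δ r²)`.
  set δ : ℝ := min 1 (b / (4 * (m + 1))) with hδ
  have hδ0 : 0 < δ := lt_min one_pos (by positivity)
  have hδ1 : δ ≤ 1 := min_le_left _ _
  have hδb : m * δ ≤ b / 4 := by
    calc m * δ ≤ (m + 1) * (b / (4 * (m + 1))) := by
          gcongr
          · linarith
          · exact min_le_right _ _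
      _ = b / 4 := by field_simp
  refine ((integrable_exp_neg_mul_norm_sq (N := N) (half_pos hb)).const_mul
    ((δ⁻¹) ^ m * Real.exp (c ^ 2 / b))).mono' (Continuous.aestronglyMeasurable (by fun_prop))
    (Eventually.of_forall fun x => ?_)
  rw [Real.norm_of_nonneg (by positivity)]
  have h1 : (1 + ‖x‖ ^ 2) ^ m ≤ (δ⁻¹) ^ m * Real.exp (m * δ * ‖x‖ ^ 2) := by
    have h2 : 1 + ‖x‖ ^ 2 ≤ δ⁻¹ * Real.exp (δ * ‖x‖ ^ 2) := by
      have h3 := Real.add_one_le_exp (δ * ‖x‖ ^ 2)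
      have h4 : 1 ≤ δ⁻¹ := (one_le_inv₀ hδ0).2 hδ1
      calc 1 + ‖x‖ ^ 2 ≤ δ⁻¹ * (δ * ‖x‖ ^ 2 + 1) := by
            rw [mul_add, ← mul_assoc, inv_mul_cancel₀ hδ0.ne']
            linarith
        _ ≤ _ := by gcongr
    calc (1 + ‖x‖ ^ 2) ^ m ≤ (δ⁻¹ * Real.exp (δ * ‖x‖ ^ 2)) ^ m := by gcongr
      _ = _ := by rw [mul_pow, ← Real.exp_nat_mul, mul_assoc]
  have h5 : c * ‖x‖ ≤ c ^ 2 / b + b / 4 * ‖x‖ ^ 2 := by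
    have : c ^ 2 / b + b / 4 * ‖x‖ ^ 2 - c * ‖x‖ = (c - b / 2 * ‖x‖) ^ 2 / b := by
      field_simp
      ring
    have h6 : 0 ≤ (c - b / 2 * ‖x‖) ^ 2 / b := by positivity
    linarith
  calc _ ≤ ((δ⁻¹) ^ m * Real.exp (m * δ * ‖x‖ ^ 2)) *
        Real.exp (c ^ 2 / b + b / 4 * ‖x‖ ^ 2) * Real.exp (-b * ‖x‖ ^ 2) := by gcongr
    _ = (δ⁻¹) ^ m * Real.exp (m * δ * ‖x‖ ^ 2 + (c ^ 2 / b + b / 4 * ‖x‖ ^ 2) + -b * ‖x‖ ^ 2) := by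
        rw [Real.exp_add _ (-b * ‖x‖ ^ 2), Real.exp_add (m * δ * ‖x‖ ^ 2)]
        ring
    _ ≤ (δ⁻¹) ^ m * Real.exp (c ^ 2 / b + -(b / 2) * ‖x‖ ^ 2) := by
        refine mul_le_mul_of_nonneg_left (Real.exp_le_exp.2 ?_) (by positivity)
        have : m * δ * ‖x‖ ^ 2 ≤ b / 4 * ‖x‖ ^ 2 := by gcongr
        linarith
    _ = _ := by rw [Real.exp_add]; ring

theorem abs_inner_outerSq_le (A : SymForm N) (x : State N) :
    |inner ℝ A (outerSq x)| ≤ ‖A‖ * ‖x‖ ^ 2 := by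
  rw [← norm_outerSq]
  exact abs_real_inner_le_norm _ _

/-- Domination near zero coupling. -/
theorem dominatedFamily_of_posDef (hVm : Measurable V) (hVexp : AtMostExpGrowth V)
    {A₀ : SymForm N} {a : ℝ} (ha : 0 < a)
    (hA₀ : ∀ x : State N, a * ‖x‖ ^ 2 ≤ inner ℝ A₀ (outerSq x)) :
    DominatedFamily volume outerSq (weight V)
      (Metric.ball A₀ (a / 2) ×ˢ (Set.univ : Set ℝ)) where
  isOpen := Metric.isOpen_ball.prod isOpen_univ
  stat_meas := continuous_outerSq.aestronglyMeasurable
  weight_meas k ε := (measurable_weight hVm k ε).aestronglyMeasurable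
  hasDerivAt k x ε := hasDerivAt_weight k x ε
  -- The derivatives of `cutExp` are bounded on all of `ℝ`, so the estimate is uniform over every
  -- coupling. The factor `V ^ k` grows at most like `exp (k * C * ‖x‖)`, which the remaining
  -- Gaussian rate `a / 2` absorbs.
  dominated k m := by
    obtain ⟨M, hM0, hM⟩ := exists_bound_iteratedDeriv_cutExp k
    obtain ⟨B, C, hB, hC, hV⟩ := hVexp
    refine ⟨_, (integrable_poly_mul_exp (half_pos ha) (k * C) m).const_mul (B ^ k * M),
      fun p hp x => ?_⟩
    rw [norm_outerSq, weight, abs_mul, abs_pow]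
    have h1 : ‖p.1 - A₀‖ < a / 2 := by simpa [dist_eq_norm] using hp.1
    have h2 : -inner ℝ p.1 (outerSq x) ≤ -(a / 2) * ‖x‖ ^ 2 := by
      have h3 := abs_le.1 (abs_inner_outerSq_le (p.1 - A₀) x)
      rw [inner_sub_left] at h3
      have h4 : ‖p.1 - A₀‖ * ‖x‖ ^ 2 ≤ a / 2 * ‖x‖ ^ 2 := by gcongr
      linarith [h3.1, hA₀ x]
    have h5 : |V x| ^ k ≤ B ^ k * Real.exp (k * C * ‖x‖) := by
      calc |V x| ^ k ≤ (B * Real.exp (C * ‖x‖)) ^ k := by gcongr; exact hV x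
        _ = _ := by rw [mul_pow, ← Real.exp_nat_mul, mul_assoc]
    calc _ ≤ (1 + ‖x‖ ^ 2) ^ m * ((B ^ k * Real.exp (k * C * ‖x‖)) * M) *
          Real.exp (-(a / 2) * ‖x‖ ^ 2) := by
          gcongr
          exact hM _
      _ = _ := by ring

/-- Domination near a positive coupling, at an interior point of the domain of the free energy. -/
theorem exists_dominatedFamily_of_interior (hVm : Measurable V) (hV : ∀ x, 0 ≤ V x)
    {A₀ : SymForm N} {ε₀ b : ℝ} (hε₀ : 0 < ε₀) (hb : 0 < b)
    (hint : Integrable fun x : State N =>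
      Real.exp (-(ε₀ * V x) - inner ℝ A₀ (outerSq x) + b * ‖x‖ ^ 2)) :
    ∃ O, DominatedFamily volume outerSq (weight V) O ∧ (A₀, ε₀) ∈ O := by
  -- With `θ = 1 / n`, the integrand is split as `u ^ (1 - θ) * v`, where `u` is the given
  -- integrable function and `v` a polynomial times a Gaussian. The two lower bounds on `n` give `θ
  -- ≤ 1 / 2` and `θ * ‖A₀‖ ≤ b / 8`.
  obtain ⟨n, hn⟩ := exists_nat_ge (max 2 (8 * ‖A₀‖ / b))
  have hn2 : (2 : ℝ) ≤ n := (le_max_left _ _).trans hn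
  have hn0 : n ≠ 0 := by
    rintro rfl
    norm_num at hn2
  have hnpos : (0 : ℝ) < n := by linarith
  set θ : ℝ := (n : ℝ)⁻¹ with hθ
  have hθ0 : 0 < θ := by positivity
  have hθ2 : θ ≤ 1 / 2 := by
    rw [hθ, one_div]
    exact inv_anti₀ two_pos hn2
  have hθA : θ * ‖A₀‖ ≤ b / 8 := by
    have h1 : 8 * ‖A₀‖ / b ≤ n := (le_max_right _ _).trans hn
    rw [div_le_iff₀ hb] at h1
    rw [hθ, inv_mul_le_iff₀ hnpos]
    linarith
  refine ⟨Metric.ball A₀ (b / 8) ×ˢ Set.Ioi ((1 - θ / 2) * ε₀),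
    ⟨Metric.isOpen_ball.prod isOpen_Ioi, continuous_outerSq.aestronglyMeasurable,
      fun k ε => (measurable_weight hVm k ε).aestronglyMeasurable, hasDerivAt_weight,
      fun k m => ?_⟩, Metric.mem_ball_self (by positivity), ?_⟩
  swap
  · rw [Set.mem_Ioi]
    nlinarith
  set K : ℝ := k ! * (2 / (θ * ε₀)) ^ k with hK
  refine ⟨_, ((hint.const_mul (1 - θ)).add ((integrable_poly_mul_exp (N := N)
    (show 0 < n * (b / 4) by positivity) 0 (m * n)).const_mul θ)).const_mul K, fun p hp x => ?_⟩
  obtain ⟨hp1, hp2⟩ := hp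
  rw [Set.mem_Ioi] at hp2
  have hε : 0 ≤ p.2 := by
    refine le_trans ?_ hp2.le
    have : 0 ≤ 1 - θ / 2 := by linarith
    positivity
  have hA : ‖p.1 - A₀‖ ≤ b / 8 := by
    have : ‖p.1 - A₀‖ < b / 8 := by simpa [dist_eq_norm] using hp1
    exact this.le
  rw [norm_outerSq, weight_of_nonneg hV k hε, abs_mul, abs_pow, abs_neg, abs_one, one_pow, one_mul,
    abs_of_nonneg (mul_nonneg (pow_nonneg (hV x) k) (Real.exp_pos _).le)]
  -- Half of the coupling reserve `θ * ε₀` pays for `V ^ k`. The other half is what allows `ε` to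
  -- drop to `(1 - θ / 2) * ε₀`.
  have hVk : V x ^ k ≤ K * Real.exp (θ * ε₀ / 2 * V x) := by
    have h1 := Real.pow_div_factorial_le_exp (θ * ε₀ / 2 * V x)
      (mul_nonneg (by positivity) (hV x)) k
    rw [div_le_iff₀ (by positivity)] at h1
    calc V x ^ k = (2 / (θ * ε₀)) ^ k * (θ * ε₀ / 2 * V x) ^ k := by
          rw [← mul_pow]
          congr 1
          field_simp
      _ ≤ (2 / (θ * ε₀)) ^ k * (Real.exp (θ * ε₀ / 2 * V x) * k !) := by gcongr
      _ = _ := by rw [hK]; ring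
  -- The shift from `A₀` to `p.1` and the missing fraction `θ` of `A₀` each cost `b / 8`. Since `(1
  -- - θ) * b ≥ b / 2`, a Gaussian rate `b / 4` is left for `v`.
  have hexpo : θ * ε₀ / 2 * V x - p.2 * V x - inner ℝ p.1 (outerSq x) ≤
      (1 - θ) * (-(ε₀ * V x) - inner ℝ A₀ (outerSq x) + b * ‖x‖ ^ 2) + -(b / 4) * ‖x‖ ^ 2 := by
    have h1 : (1 - θ / 2) * ε₀ * V x ≤ p.2 * V x := by
      gcongr
      exact hV x
    have h2 := abs_le.1 (abs_inner_outerSq_le (p.1 - A₀) x)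
    rw [inner_sub_left] at h2
    have h3 : ‖p.1 - A₀‖ * ‖x‖ ^ 2 ≤ b / 8 * ‖x‖ ^ 2 := by gcongr
    have h4 := abs_le.1 (abs_inner_outerSq_le A₀ x)
    have h5 : θ * inner ℝ A₀ (outerSq x) ≤ b / 8 * ‖x‖ ^ 2 := by
      calc θ * inner ℝ A₀ (outerSq x) ≤ θ * (‖A₀‖ * ‖x‖ ^ 2) := by
            gcongr
            exact h4.2
        _ = θ * ‖A₀‖ * ‖x‖ ^ 2 := by ring
        _ ≤ _ := by gcongr
    have h6 : θ * (b * ‖x‖ ^ 2) ≤ 1 / 2 * (b * ‖x‖ ^ 2) := by gcongr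
    nlinarith [h2.1]
  set u : ℝ := Real.exp (-(ε₀ * V x) - inner ℝ A₀ (outerSq x) + b * ‖x‖ ^ 2) with hu
  set v : ℝ := (1 + ‖x‖ ^ 2) ^ m * Real.exp (-(b / 4) * ‖x‖ ^ 2) with hv
  have hv0 : 0 ≤ v := by positivity
  have hvn : v ^ n = (1 + ‖x‖ ^ 2) ^ (m * n) * Real.exp (0 * ‖x‖) *
      Real.exp (-(n * (b / 4)) * ‖x‖ ^ 2) := by
    rw [hv, mul_pow, ← pow_mul, ← Real.exp_nat_mul]
    simp only [zero_mul, Real.exp_zero, mul_one]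
    congr 2
    ring
  -- Weighted AM–GM. As `1 / θ` is the natural number `n`, the power `v ^ n` is again a polynomial
  -- times a Gaussian.
  have hyoung : u ^ (1 - θ) * v ≤ (1 - θ) * u + θ * v ^ n := by
    have := Real.geom_mean_le_arith_mean2_weighted (w₁ := 1 - θ) (w₂ := θ) (p₁ := u) (p₂ := v ^ n)
      (by linarith) hθ0.le (Real.exp_pos _).le (by positivity) (by ring)
    rwa [hθ, Real.pow_rpow_inv_natCast hv0 hn0] at this
  calc _ ≤ (1 + ‖x‖ ^ 2) ^ m * (K * Real.exp (θ * ε₀ / 2 * V x) * Real.exp (-(p.2 * V x))) *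
        Real.exp (-inner ℝ p.1 (outerSq x)) := by gcongr
    _ = K * ((1 + ‖x‖ ^ 2) ^ m *
        Real.exp (θ * ε₀ / 2 * V x - p.2 * V x - inner ℝ p.1 (outerSq x))) := by
        rw [Real.exp_sub, Real.exp_sub, Real.exp_neg, Real.exp_neg]
        field_simp
    _ ≤ K * ((1 + ‖x‖ ^ 2) ^ m * Real.exp ((1 - θ) *
        (-(ε₀ * V x) - inner ℝ A₀ (outerSq x) + b * ‖x‖ ^ 2) + -(b / 4) * ‖x‖ ^ 2)) := by
        gcongr
    _ = K * (u ^ (1 - θ) * v) := by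
        rw [hu, hv, ← Real.exp_mul, Real.exp_add, mul_comm (1 - θ)]
        ring
    _ ≤ K * ((1 - θ) * u + θ * v ^ n) := by gcongr
    _ = _ := by
        rw [hvn]
        rfl

end Weight

/-! ### Smooth continuation of `ℱ` from one solution of the moment equation. -/

section LocalSmoothness

variable {N : ℕ} {V : State N → ℝ}

/-- Polarisation: the values at `e_i`, `e_j` and `e_i + e_j` determine the entry `(i, j)`. -/
theorem SymForm.eq_zero_of_inner_outerSq {a : SymForm N}
    (h : ∀ x : State N, inner ℝ a (outerSq x) = 0) : a = 0 := by
  have hq : ∀ i j, (Pi.single i 1 : Fin N → ℝ) ⬝ᵥ (a.toMat *ᵥ Pi.single j 1) = a.1 (i, j) := by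
    intro i j
    simp
  have h1 : ∀ x : Fin N → ℝ, x ⬝ᵥ (a.toMat *ᵥ x) = 0 := fun x => by
    simpa [inner_outerSq, quadForm] using h (WithLp.toLp 2 x)
  refine SymForm.ext_entry fun i j => ?_
  have h2 := h1 (Pi.single i 1 + Pi.single j 1)
  rw [Matrix.mulVec_add, add_dotProduct, dotProduct_add, dotProduct_add, h1, h1, hq, hq,
    a.2 j i] at h2
  rw [SymForm.zero_val]
  linarith

/-- This is the nondegeneracy needed for inversion. Continuity turns almost everywhere into
everywhere, and the value at `x = 0` forces `m = 0`. -/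
theorem SymForm.eq_zero_of_ae_inner_outerSq {a : SymForm N} {m : ℝ}
    (h : ∀ᵐ x : State N, inner ℝ a (outerSq x) = m) : a = 0 := by
  have hcont : Continuous fun x : State N => inner ℝ a (outerSq x) :=
    continuous_const.inner continuous_outerSq
  have h1 := (hcont.ae_eq_iff_eq volume continuous_const).1 h
  have h0 : m = 0 := by
    have := congrFun h1 0
    simpa [outerSq_zero] using this.symm
  exact SymForm.eq_zero_of_inner_outerSq fun x => (congrFun h1 x).trans h0

theorem weight_mul_exp (hV : ∀ x, 0 ≤ V x) {ε : ℝ} (hε : 0 ≤ ε) (A : SymForm N) (x : State N) :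
    weight V 0 ε x * Real.exp (-inner ℝ A (outerSq x)) =
      Real.exp (-inner ℝ A (outerSq x) - (ε • V) x) := by
  rw [weight_zero_of_nonneg hV hε, ← Real.exp_add, Pi.smul_apply, smul_eq_mul]
  congr 1
  ring

theorem tiltedIntegral_one (hV : ∀ x, 0 ≤ V x) {ε : ℝ} (hε : 0 ≤ ε) (A : SymForm N) :
    tiltedIntegral volume outerSq (weight V) 0 (fun _ => (1 : ℝ)) (A, ε) =
      ∫ x : State N, Real.exp (-inner ℝ A (outerSq x) - (ε • V) x) := by
  simp only [tiltedIntegral, weight_mul_exp hV hε, smul_eq_mul, mul_one]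

theorem tiltedIntegral_outerSq (hV : ∀ x, 0 ≤ V x) {ε : ℝ} (hε : 0 ≤ ε) (A : SymForm N) :
    tiltedIntegral volume outerSq (weight V) 0 outerSq (A, ε) =
      ∫ x : State N, Real.exp (-inner ℝ A (outerSq x) - (ε • V) x) • outerSq x := by
  simp only [tiltedIntegral, weight_mul_exp hV hε]

/-- Near a solution of the moment equation, `ℱ[g, εV]` is given by a smooth function of `(g, ε)`. -/
theorem exists_smooth_calF (hVm : Measurable V) (hV : ∀ x, 0 ≤ V x) {O : Set (SymForm N × ℝ)}
    (h : DominatedFamily volume outerSq (weight V) O) {A₀ g₀ : SymForm N} {ε₀ : ℝ}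
    (hmem : (A₀, ε₀) ∈ O) (hε₀ : 0 ≤ ε₀)
    (hg₀ : ∫ x : State N, Real.exp (-inner ℝ A₀ (outerSq x) - (ε₀ • V) x) • outerSq x =
      (∫ x : State N, Real.exp (-inner ℝ A₀ (outerSq x) - (ε₀ • V) x)) • g₀) :
    ∃ W : Set (SymForm N × ℝ), IsOpen W ∧ (g₀, ε₀) ∈ W ∧ ∃ Ψ : SymForm N × ℝ → ℝ,
      ContDiffOn ℝ ∞ Ψ W ∧ ∀ q ∈ W, 0 ≤ q.2 → calF q.1.toMat (q.2 • V) = (Ψ q : EReal) := by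
  rw [← tiltedIntegral_one hV hε₀, ← tiltedIntegral_outerSq hV hε₀] at hg₀
  obtain ⟨W, hW, hgW, S, hS, -, hSW⟩ := h.exists_smooth_parameter hmem
    (fun x => by rw [weight_zero_of_nonneg hV hε₀]; exact Real.exp_pos _)
    (fun a m => SymForm.eq_zero_of_ae_inner_outerSq) hg₀
  have hZ := h.contDiffOn (polyGrowth_const (1 : ℝ)) 0
  refine ⟨W, hW, hgW, fun q => inner ℝ (S q) q.1 +
    Real.log (tiltedIntegral volume outerSq (weight V) 0 (fun _ => (1 : ℝ)) (S q, q.2)), ?_, ?_⟩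
  · refine (hS.inner ℝ contDiff_fst.contDiffOn).add (ContDiffOn.log ?_ fun q hq =>
      (hSW q hq).2.1.ne')
    exact hZ.comp (hS.prodMk contDiff_snd.contDiffOn) fun q hq => (hSW q hq).1
  · intro q hq hε
    obtain ⟨hO, hpos, hmom⟩ := hSW q hq
    beta_reduce
    rw [tiltedIntegral_one hV hε]
    rw [tiltedIntegral_one hV hε, tiltedIntegral_outerSq hV hε] at hmom
    refine calF_eq_of_gibbs (hVm.const_smul _) (fun x => mul_nonneg hε (hV x)) (S q) ?_ ?_ ?_ hmom
    · have := h.integrable (polyGrowth_const (1 : ℝ)) 0 hO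
      simpa only [weight_mul_exp hV hε, smul_eq_mul, mul_one] using this
    -- For `ε ≥ 0` the weight of index one is `-V exp (-εV)`, so multiplying by `-ε` produces the
    -- integrand with `εV`.
    · have := (h.integrable (polyGrowth_const (1 : ℝ)) 1 hO).const_mul (-q.2)
      refine this.congr (Eventually.of_forall fun x => ?_)
      simp only [smul_eq_mul, mul_one, Pi.smul_apply]
      rw [weight_of_nonneg hV 1 hε, sub_eq_add_neg, Real.exp_add]
      ring
    · have := h.integrable h.polyGrowth_stat 0 hO
      simpa only [weight_mul_exp hV hε] using this

end LocalSmoothness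

/-! ### The non-interacting case: Gaussian integrals. -/

section Gaussian

variable {N : ℕ}

open scoped MatrixOrder Matrix.Norms.L2Operator in
theorem exists_eq_transpose_mul_self {P : Matrix (Fin N) (Fin N) ℝ} (hP : P.PosDef) :
    ∃ B : Matrix (Fin N) (Fin N) ℝ, P = Bᵀ * B := by
  obtain ⟨B, hB⟩ := CStarAlgebra.nonneg_iff_eq_star_mul_self.mp hP.posSemidef.nonneg
  exact ⟨B, by rw [hB, Matrix.star_eq_conjTranspose, Matrix.conjTranspose_eq_transpose_of_trivial]⟩

/-- The natural parameter `½ G⁻¹` of the centred Gaussian with covariance `G`. -/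
def gaussParam (g : SymForm N) : SymForm N := (1 / 2 : ℝ) • SymForm.ofMat g.toMat⁻¹

theorem inner_gaussParam (g : SymForm N) (x : State N) :
    inner ℝ (gaussParam g) (outerSq x) = 1 / 2 * quadForm g.toMat⁻¹ x := by
  rw [gaussParam, real_inner_smul_left, inner_outerSq, SymForm.toMat_ofMat]
  rw [Matrix.IsSymm, Matrix.transpose_nonsing_inv, g.toMat_isSymm]

theorem gaussParam_coercive {g : SymForm N} (hg : g.toMat.PosDef) :
    ∃ a, 0 < a ∧ ∀ x : State N, a * ‖x‖ ^ 2 ≤ inner ℝ (gaussParam g) (outerSq x) := by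
  have h1 : (SymForm.ofMat g.toMat⁻¹).toMat = g.toMat⁻¹ :=
    SymForm.toMat_ofMat (by rw [Matrix.IsSymm, Matrix.transpose_nonsing_inv, g.toMat_isSymm])
  obtain ⟨a, ha, h⟩ := (SymForm.posDef_toMat_iff _).1 (h1.symm ▸ hg.inv)
  refine ⟨1 / 2 * a, by positivity, fun x => ?_⟩
  rw [gaussParam, real_inner_smul_left]
  linarith [h x]

theorem inner_gaussParam_self {g : SymForm N} (hg : g.toMat.PosDef) :
    inner ℝ (gaussParam g) g = N / 2 := by
  have h1 : (SymForm.ofMat g.toMat⁻¹).toMat = g.toMat⁻¹ :=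
    SymForm.toMat_ofMat (by rw [Matrix.IsSymm, Matrix.transpose_nonsing_inv, g.toMat_isSymm])
  have h2 : inner ℝ (SymForm.ofMat g.toMat⁻¹) g = (g.toMat⁻¹ * g.toMat).trace := by
    rw [inner_symForm, Matrix.trace]
    refine Finset.sum_congr rfl fun i _ => ?_
    rw [Matrix.diag_apply, Matrix.mul_apply]
    refine Finset.sum_congr rfl fun j _ => ?_
    rw [← SymForm.toMat_apply, h1, g.2 i j, SymForm.toMat_apply]
  rw [gaussParam, real_inner_smul_left, h2,
    Matrix.nonsing_inv_mul _ (hg.det_pos.ne'.isUnit), Matrix.trace_one]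
  simp
  ring

/-- Writing `G⁻¹ = Bᵀ B` and substituting `y = B x` reduces to the standard Gaussian, with `(det B)²
= 1 / det G`. -/
theorem log_integral_gauss {g : SymForm N} (hg : g.toMat.PosDef) :
    Real.log (∫ x : State N, Real.exp (-inner ℝ (gaussParam g) (outerSq x))) =
      N / 2 * Real.log (2 * Real.pi) + 1 / 2 * Real.log g.toMat.det := by
  obtain ⟨B, hB⟩ := exists_eq_transpose_mul_self hg.inv
  have hdet : B.det ^ 2 = g.toMat.det⁻¹ := by
    have := congrArg Matrix.det hB
    rw [Matrix.det_nonsing_inv, Ring.inverse_eq_inv', Matrix.det_mul, Matrix.det_transpose] at this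
    rw [this, sq]
  have hB0 : B.det ≠ 0 := by
    intro h
    rw [h] at hdet
    exact inv_ne_zero hg.det_pos.ne' (by simpa using hdet.symm)
  set f : State N →ₗ[ℝ] State N := Matrix.toLpLin 2 2 B with hf
  have hfdet : LinearMap.det f = B.det := LinearMap.det_toLpLin 2 B
  have hq : ∀ x : State N, -inner ℝ (gaussParam g) (outerSq x) = -(1 / 2) * ‖f x‖ ^ 2 := by
    intro x
    rw [inner_gaussParam, hB, quadForm, ← Matrix.mulVec_mulVec, Matrix.dotProduct_mulVec,
      Matrix.vecMul_transpose, EuclideanSpace.norm_sq_eq]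
    simp [hf, dotProduct, sq]
  have hmap : Measure.map f volume = ENNReal.ofReal |(LinearMap.det f)⁻¹| • volume :=
    Measure.map_linearMap_addHaar_eq_smul_addHaar volume (by rwa [hfdet])
  have hcont : Continuous f := f.continuous_of_finiteDimensional
  have hint : ∫ x : State N, Real.exp (-inner ℝ (gaussParam g) (outerSq x)) =
      |B.det|⁻¹ * (Real.pi / (1 / 2)) ^ ((N : ℝ) / 2) := by
    simp_rw [hq]
    rw [← integral_map (f := fun y => Real.exp (-(1 / 2) * ‖y‖ ^ 2))
      hcont.measurable.aemeasurable (Continuous.aestronglyMeasurable (by fun_prop)), hmap,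
      integral_smul_measure, GaussianFourier.integral_rexp_neg_mul_sq_norm (by norm_num), hfdet,
      ENNReal.toReal_ofReal (abs_nonneg _), abs_inv]
    simp
  have hlog : Real.log |B.det| = -(1 / 2) * Real.log g.toMat.det := by
    have h1 := congrArg Real.log hdet
    rw [Real.log_inv, Real.log_pow] at h1
    rw [Real.log_abs]
    push_cast at h1
    linarith
  have hB1 : |B.det|⁻¹ ≠ 0 := inv_ne_zero (abs_ne_zero.2 hB0)
  rw [hint, Real.log_mul hB1 (by positivity), Real.log_inv, hlog, Real.log_rpow (by positivity),
    show Real.pi / (1 / 2) = 2 * Real.pi by ring]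
  ring

theorem integrable_gauss {g : SymForm N} (hg : g.toMat.PosDef) (c : ℝ) (m : ℕ) :
    Integrable fun x : State N => (1 + ‖x‖ ^ 2) ^ m * Real.exp (c * ‖x‖) *
      Real.exp (-inner ℝ (gaussParam g) (outerSq x)) := by
  obtain ⟨a, ha, h⟩ := gaussParam_coercive hg
  have hcont : Continuous fun x : State N => inner ℝ (gaussParam g) (outerSq x) :=
    continuous_const.inner continuous_outerSq
  refine (integrable_poly_mul_exp ha c m).mono' (Continuous.aestronglyMeasurable (by fun_prop))
    (Eventually.of_forall fun x => ?_)
  rw [Real.norm_of_nonneg (by positivity)]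
  gcongr
  linarith [h x]

theorem integrable_gauss_of_le {F : Type*} [NormedAddCommGroup F] [NormedSpace ℝ F] {g : SymForm N}
    (hg : g.toMat.PosDef) {f : State N → F} (hf : AEStronglyMeasurable f volume) {K c : ℝ} {m : ℕ}
    (hfb : ∀ x, ‖f x‖ ≤ K * ((1 + ‖x‖ ^ 2) ^ m * Real.exp (c * ‖x‖))) :
    Integrable fun x : State N => Real.exp (-inner ℝ (gaussParam g) (outerSq x)) • f x := by
  have hcont : Continuous fun x : State N => inner ℝ (gaussParam g) (outerSq x) :=
    continuous_const.inner continuous_outerSq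
  refine ((integrable_gauss hg c m).const_mul K).mono'
    (AEStronglyMeasurable.smul (Continuous.aestronglyMeasurable (by fun_prop)) hf)
    (Eventually.of_forall fun x => ?_)
  rw [norm_smul, Real.norm_of_nonneg (Real.exp_pos _).le]
  calc _ ≤ Real.exp (-inner ℝ (gaussParam g) (outerSq x)) *
        (K * ((1 + ‖x‖ ^ 2) ^ m * Real.exp (c * ‖x‖))) := by gcongr; exact hfb x
    _ = _ := by ring

theorem abs_coord_le (x : State N) (i : Fin N) : |x i| ≤ 1 + ‖x‖ ^ 2 := by
  have h1 : |x i| ≤ ‖x‖ := PiLp.norm_apply_le x i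
  nlinarith [norm_nonneg x]

theorem abs_coord_mul_le (x : State N) (i j : Fin N) : |x i * x j| ≤ 1 + ‖x‖ ^ 2 := by
  have h1 : |x i| ≤ ‖x‖ := PiLp.norm_apply_le x i
  have h2 : |x j| ≤ ‖x‖ := PiLp.norm_apply_le x j
  rw [abs_mul]
  calc |x i| * |x j| ≤ ‖x‖ * ‖x‖ := by gcongr
    _ ≤ _ := by nlinarith

theorem hasFDerivAt_quadForm {P : Matrix (Fin N) (Fin N) ℝ} (hP : P.IsSymm) (x : State N) :
    ∃ L : State N →L[ℝ] ℝ, HasFDerivAt (quadForm P) L x ∧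
      ∀ k, L (EuclideanSpace.single k 1) = 2 * (P *ᵥ x.ofLp) k := by
  have h1 : ∀ i j : Fin N, HasFDerivAt (fun y : State N => y i * (P i j * y j))
      (x i • (P i j • (EuclideanSpace.proj j : State N →L[ℝ] ℝ)) +
        (P i j * x j) • (EuclideanSpace.proj i : State N →L[ℝ] ℝ)) x := fun i j =>
    ((EuclideanSpace.proj i : State N →L[ℝ] ℝ).hasFDerivAt).mul
      (((EuclideanSpace.proj j : State N →L[ℝ] ℝ).hasFDerivAt).const_mul (P i j))
  refine ⟨∑ i, ∑ j, (x i • (P i j • (EuclideanSpace.proj j : State N →L[ℝ] ℝ)) +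
        (P i j * x j) • (EuclideanSpace.proj i : State N →L[ℝ] ℝ)), ?_, fun k => ?_⟩
  · have : quadForm P = fun y : State N => ∑ i, ∑ j, y i * (P i j * y j) := by
      ext y
      simp [quadForm, dotProduct, Matrix.mulVec, Finset.mul_sum]
    rw [this]
    exact HasFDerivAt.fun_sum fun i _ => HasFDerivAt.fun_sum fun j _ => h1 i j
  · simp [Finset.sum_add_distrib, Matrix.mulVec, dotProduct]
    rw [two_mul]
    congr 1
    exact Finset.sum_congr rfl fun i _ => by rw [hP.apply k i, mul_comm]

/-- Integrating `x_j ∂_k γ` by parts with `∂_k γ = -γ (P x)_k` and `P = G⁻¹` gives `M P = Z • 1` for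
the matrix `M` of unnormalised second moments, hence `M = Z • G`. -/
theorem integral_gauss_outerSq {g : SymForm N} (hg : g.toMat.PosDef) :
    ∫ x : State N, Real.exp (-inner ℝ (gaussParam g) (outerSq x)) • outerSq x =
      (∫ x : State N, Real.exp (-inner ℝ (gaussParam g) (outerSq x))) • g := by
  set P := g.toMat⁻¹ with hP
  have hPs : P.IsSymm := by rw [Matrix.IsSymm, Matrix.transpose_nonsing_inv, g.toMat_isSymm]
  set γ : State N → ℝ := fun x => Real.exp (-inner ℝ (gaussParam g) (outerSq x)) with hγ
  set Z := ∫ x, γ x with hZ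
  have hγq : ∀ x, γ x = Real.exp (-(1 / 2) * quadForm P x) := fun x => by
    simp only [hγ, inner_gaussParam]
    congr 1
    ring
  have hij : ∀ i j, Integrable fun x : State N => γ x * (x i * x j) := fun i j =>
    integrable_gauss_of_le (K := 1) (c := 0) (m := 1) hg
      (f := fun x : State N => x i * x j)
      (Continuous.aestronglyMeasurable (by fun_prop)) fun x => by
        simpa using abs_coord_mul_le x i j
  have hi : ∀ i, Integrable fun x : State N => γ x * x i := fun i =>
    integrable_gauss_of_le (K := 1) (c := 0) (m := 1) hg (f := fun x : State N => x i)
      (Continuous.aestronglyMeasurable (by fun_prop)) fun x => by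
        simpa using abs_coord_le x i
  have h0 : Integrable γ := by
    simpa using integrable_gauss_of_le (K := 1) (c := 0) (m := 0) hg (f := fun _ => (1 : ℝ))
      aestronglyMeasurable_const fun x => by simp
  have hder : ∀ x k, fderiv ℝ γ x (EuclideanSpace.single k 1) = -(γ x * (P *ᵥ x.ofLp) k) ∧
      DifferentiableAt ℝ γ x := by
    intro x k
    obtain ⟨L, hL, hLk⟩ := hasFDerivAt_quadForm hPs x
    have h1 : HasFDerivAt γ (Real.exp (-(1 / 2) * quadForm P x) • ((-(1 / 2) : ℝ) • L)) x := by
      have : γ = fun x => Real.exp (-(1 / 2) * quadForm P x) := funext hγq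
      rw [this]
      exact (hL.const_mul _).exp
    refine ⟨?_, h1.differentiableAt⟩
    rw [h1.fderiv, hγq]
    simp [hLk]
  have hcoord : ∀ j (x : State N),
      HasFDerivAt (fun y : State N => y j) (EuclideanSpace.proj j : State N →L[ℝ] ℝ) x :=
    fun j x => (EuclideanSpace.proj j : State N →L[ℝ] ℝ).hasFDerivAt
  set M : Matrix (Fin N) (Fin N) ℝ := Matrix.of fun i j => ∫ x : State N, γ x * (x i * x j) with hM
  have hMP : M * P = Z • (1 : Matrix (Fin N) (Fin N) ℝ) := by
    ext j k
    have hsum : ∀ x : State N, γ x * (x j * (P *ᵥ x.ofLp) k) =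
        ∑ l, P l k * (γ x * (x j * x l)) := fun x => by
      simp only [Matrix.mulVec, dotProduct, Finset.mul_sum]
      exact Finset.sum_congr rfl fun l _ => by rw [hPs.apply k l]; ring
    have hi2 : Integrable fun x : State N => γ x * (x j * (P *ᵥ x.ofLp) k) := by
      simp_rw [hsum]
      exact integrable_finsetSum _ fun l _ => (hij j l).const_mul _
    have hf1 : ∀ x : State N, fderiv ℝ (fun y : State N => y j) x (EuclideanSpace.single k 1) =
        (1 : Matrix (Fin N) (Fin N) ℝ) j k := fun x => by
      rw [(hcoord j x).fderiv]
      simp [Matrix.one_apply]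
    have hparts := integral_mul_fderiv_eq_neg_fderiv_mul_of_integrable (μ := volume)
      (f := fun y : State N => y j) (g := γ) (v := EuclideanSpace.single k 1) (𝕜 := ℝ) ?_ ?_ ?_ ?_ ?_
    · simp only [hf1, (hder _ _).1] at hparts
      rw [integral_const_mul, ← hZ] at hparts
      have h2 : ∫ x : State N, x j * -(γ x * (P *ᵥ x.ofLp) k) =
          -∫ x : State N, γ x * (x j * (P *ᵥ x.ofLp) k) := by
        rw [← integral_neg]
        exact integral_congr_ae (Eventually.of_forall fun x => by ring)
      rw [h2, neg_inj] at hparts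
      simp_rw [hsum] at hparts
      rw [integral_finsetSum _ fun l _ => (hij j l).const_mul _] at hparts
      simp only [integral_const_mul] at hparts
      rw [Matrix.mul_apply, Matrix.smul_apply, smul_eq_mul, mul_comm Z, ← hparts]
      exact Finset.sum_congr rfl fun l _ => mul_comm _ _
    · simp only [hf1]
      exact h0.const_mul _
    · simp only [(hder _ _).1]
      refine hi2.neg.congr (Eventually.of_forall fun x => ?_)
      simp
      ring
    · exact (hi j).congr (Eventually.of_forall fun x => mul_comm _ _)
    · exact fun x _ => (hcoord j x).differentiableAt
    · exact fun x _ => (hder x k).2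
  have hMg : M = Z • g.toMat := by
    have h1 := congrArg (· * g.toMat) hMP
    simp only [Matrix.mul_assoc, Matrix.smul_mul, one_mul] at h1
    rwa [hP, Matrix.nonsing_inv_mul _ (hg.det_pos.ne'.isUnit), mul_one] at h1
  have hT : Integrable fun x : State N => γ x • outerSq x :=
    integrable_gauss_of_le (K := 1) (c := 0) (m := 1) hg
      continuous_outerSq.aestronglyMeasurable fun x => by
        rw [norm_outerSq]
        simp
  refine SymForm.ext_entry fun i j => ?_
  have h1 := (SymForm.entry i j).integral_comp_comm hT
  simp only [SymForm.entry_apply, SymForm.smul_val, outerSq_apply] at h1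
  rw [← h1, SymForm.smul_val]
  exact congrFun (congrFun hMg i) j

theorem integrable_exp_gaussParam {g : SymForm N} (hg : g.toMat.PosDef) :
    Integrable fun x : State N => Real.exp (-inner ℝ (gaussParam g) (outerSq x)) := by
  simpa using integrable_gauss_of_le (K := 1) (c := 0) (m := 0) hg (f := fun _ => (1 : ℝ))
      aestronglyMeasurable_const fun x => by simp

theorem integrable_gauss_outerSq {g : SymForm N} (hg : g.toMat.PosDef) :
    Integrable fun x : State N => Real.exp (-inner ℝ (gaussParam g) (outerSq x)) • outerSq x :=
  integrable_gauss_of_le (K := 1) (c := 0) (m := 1) hg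
    continuous_outerSq.aestronglyMeasurable fun x => by
      rw [norm_outerSq]
      simp

theorem integrable_gauss_mul_of_expGrowth {g : SymForm N} (hg : g.toMat.PosDef) {V : State N → ℝ}
    (hVm : Measurable V) (hV : AtMostExpGrowth V) :
    Integrable fun x : State N => Real.exp (-inner ℝ (gaussParam g) (outerSq x)) * V x := by
  obtain ⟨B, C, -, -, h⟩ := hV
  exact integrable_gauss_of_le (K := B) (c := C) (m := 0) hg hVm.aestronglyMeasurable fun x => by
    simpa using h x

theorem calF_zero {g : SymForm N} (hg : g.toMat.PosDef) :
    calF g.toMat 0 = ((N / 2 + (N / 2 * Real.log (2 * Real.pi) + 1 / 2 * Real.log g.toMat.det) : ℝ) :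
      EReal) := by
  have h := calF_eq_of_gibbs (V := 0) (g := g) measurable_zero (fun _ => le_rfl) (gaussParam g)
    (by simpa using integrable_exp_gaussParam hg) (by simp)
    (by simpa using integrable_gauss_outerSq hg)
    (by simpa using integral_gauss_outerSq hg)
  rw [h, inner_gaussParam_self hg]
  simp only [Pi.zero_apply, sub_zero]
  rw [log_integral_gauss hg]

/-- The terms subtracted in `Φ` are exactly twice the Gaussian entropy. This removes the term of
order zero from both series. -/
theorem luttingerWard_zero {g : SymForm N} (hg : g.toMat.PosDef) : luttingerWard g.toMat 0 = 0 := by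
  have h : Real.log (2 * Real.pi * Real.exp 1) = Real.log (2 * Real.pi) + 1 := by
    rw [Real.log_mul (by positivity) (by positivity), Real.log_exp]
  rw [luttingerWard, calF_zero hg, EReal.toReal_coe, h]
  ring

end Gaussian

/-! ### Existence of a Gibbs parameter at positive coupling, by convex duality. -/

section Minimizer

variable {N : ℕ} {V : State N → ℝ}

theorem SymForm.posDef_of_norm_sub_le {g : SymForm N} {a : ℝ} (ha : 0 < a)
    (hga : ∀ x : State N, a * ‖x‖ ^ 2 ≤ inner ℝ g (outerSq x)) {g' : SymForm N}
    (hg' : ‖g' - g‖ ≤ a / 2) : g'.toMat.PosDef := by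
  refine (SymForm.posDef_toMat_iff g').2 ⟨a / 2, by positivity, fun x => ?_⟩
  have h1 := abs_le.1 (abs_inner_outerSq_le (g' - g) x)
  rw [inner_sub_left] at h1
  have h2 : ‖g' - g‖ * ‖x‖ ^ 2 ≤ a / 2 * ‖x‖ ^ 2 := by gcongr
  linarith [h1.1, hga x]

theorem SymForm.eventually_posDef {g : SymForm N} (hg : g.toMat.PosDef) :
    ∀ᶠ g' in 𝓝 g, g'.toMat.PosDef := by
  obtain ⟨a, ha, hga⟩ := (SymForm.posDef_toMat_iff g).1 hg
  filter_upwards [Metric.closedBall_mem_nhds g (half_pos ha)] with g' hg'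
  exact SymForm.posDef_of_norm_sub_le ha hga (by simpa [dist_eq_norm] using hg')

/-- The dual functional `exp (⟪A, g⟫) Z[A, W]`, as an extended nonnegative number. -/
def dualFn (g : SymForm N) (W : State N → ℝ) (A : SymForm N) : ℝ≥0∞ :=
  ∫⁻ x : State N, ENNReal.ofReal (Real.exp (inner ℝ A g - inner ℝ A (outerSq x) - W x))

theorem measurable_exp_sub {W : State N → ℝ} (hW : Measurable W) (c : ℝ) (A : SymForm N) :
    Measurable fun x : State N => Real.exp (c - inner ℝ A (outerSq x) - W x) := by
  have : Measurable fun x : State N => inner ℝ A (outerSq x) :=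
    (continuous_const.inner continuous_outerSq).measurable
  fun_prop

/-- Fatou's lemma. Allowing the value `∞` keeps the functional lower semicontinuous on the whole
space. -/
theorem lowerSemicontinuous_dualFn (g : SymForm N) {W : State N → ℝ} (hW : Measurable W) :
    LowerSemicontinuous (dualFn g W) := by
  rw [lowerSemicontinuous_iff_le_liminf]
  intro A
  refine le_trans (le_of_eq ?_) (lintegral_liminf_le fun A' =>
    (measurable_exp_sub hW (inner ℝ A' g) A').ennreal_ofReal)
  refine lintegral_congr fun x => ?_
  have h : Continuous fun A' : SymForm N =>
      ENNReal.ofReal (Real.exp (inner ℝ A' g - inner ℝ A' (outerSq x) - W x)) := by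
    refine ENNReal.continuous_ofReal.comp (Real.continuous_exp.comp ?_)
    exact ((continuous_id.inner continuous_const).sub
      (continuous_id.inner continuous_const)).sub continuous_const
  exact (h.tendsto A).liminf_eq.symm

theorem integrable_of_dualFn_lt_top {g : SymForm N} {W : State N → ℝ} (hW : Measurable W)
    {A : SymForm N} (h : dualFn g W A < ⊤) :
    Integrable fun x : State N => Real.exp (inner ℝ A g - inner ℝ A (outerSq x) - W x) := by
  refine ⟨(measurable_exp_sub hW _ A).aestronglyMeasurable, ?_⟩
  rw [hasFiniteIntegral_iff_norm]
  simpa [dualFn, Real.norm_of_nonneg (Real.exp_pos _).le] using h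

theorem dualFn_eq {g : SymForm N} {W : State N → ℝ} {A : SymForm N}
    (h : Integrable fun x : State N => Real.exp (inner ℝ A g - inner ℝ A (outerSq x) - W x)) :
    dualFn g W A =
      ENNReal.ofReal (∫ x : State N, Real.exp (inner ℝ A g - inner ℝ A (outerSq x) - W x)) := by
  rw [ofReal_integral_eq_lintegral_ofReal h (Eventually.of_forall fun x => (Real.exp_pos _).le)]
  rfl

/-- Testing against a Gaussian bounds the dual functional below by an affine function. -/
theorem exists_affine_le_dual (g : SymForm N) {W : State N → ℝ} (hWm : Measurable W)
    (hWexp : AtMostExpGrowth W) {g' : SymForm N} (hg' : g'.toMat.PosDef) :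
    ∃ C : ℝ, ∀ A : SymForm N,
      Integrable (fun x : State N => Real.exp (inner ℝ A g - inner ℝ A (outerSq x) - W x)) →
      C + inner ℝ A (g - g') ≤
        ∫ x : State N, Real.exp (inner ℝ A g - inner ℝ A (outerSq x) - W x) := by
  set P := gaussParam g' with hP
  set γ : State N → ℝ := fun x => Real.exp (-inner ℝ P (outerSq x)) with hγ
  have hγi : Integrable γ := integrable_exp_gaussParam hg'
  set Z := ∫ x, γ x with hZ
  have hZpos : 0 < Z := integral_exp_pos hγi
  have hγT : Integrable fun x => γ x • outerSq x := integrable_gauss_outerSq hg'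
  have hγW : Integrable fun x => γ x * W x := integrable_gauss_mul_of_expGrowth hg' hWm hWexp
  have hγB : ∀ B : SymForm N, Integrable (fun x => γ x * inner ℝ B (outerSq x)) ∧
      ∫ x, γ x * inner ℝ B (outerSq x) = Z * inner ℝ B g' := fun B => by
    have h1 := hγT.const_inner (𝕜 := ℝ) B
    have h2 := integral_inner (𝕜 := ℝ) hγT B
    rw [integral_gauss_outerSq hg', real_inner_smul_right] at h2
    simp only [real_inner_smul_right] at h1 h2
    exact ⟨h1, h2⟩
  refine ⟨1 - Z⁻¹ * (∫ x, γ x * W x) + inner ℝ P g' + Real.log Z, fun A hA => ?_⟩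
  -- This is `exp t ≥ 1 + t` with `t` the exponent minus the logarithm of the normalised Gaussian
  -- density. Integrated against that density, the bound becomes affine in `A` with slope `g - g'`.
  have hpt : ∀ x, Z⁻¹ * ((1 + inner ℝ A g + Real.log Z) * γ x - γ x * inner ℝ A (outerSq x)
      - γ x * W x + γ x * inner ℝ P (outerSq x)) ≤
      Real.exp (inner ℝ A g - inner ℝ A (outerSq x) - W x) := by
    intro x
    set t := inner ℝ A g - inner ℝ A (outerSq x) - W x + inner ℝ P (outerSq x) + Real.log Z with ht
    have h1 : Real.exp (inner ℝ A g - inner ℝ A (outerSq x) - W x) = Z⁻¹ * (γ x * Real.exp t) := by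
      have : inner ℝ A g - inner ℝ A (outerSq x) - W x =
        -Real.log Z + (-inner ℝ P (outerSq x) + t) := by rw [ht]; ring
      rw [this, Real.exp_add, Real.exp_add, Real.exp_neg (Real.log Z), Real.exp_log hZpos]
    rw [h1]
    have h2 := Real.add_one_le_exp t
    calc _ = Z⁻¹ * (γ x * (t + 1)) := by rw [ht]; ring
      _ ≤ _ := by
        have : 0 < γ x := Real.exp_pos _
        gcongr
  have i1 := (hγi.const_mul (1 + inner ℝ A g + Real.log Z)).sub (hγB A).1
  have i2 := i1.sub hγW
  have i3 := i2.add (hγB P).1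
  refine le_trans (le_of_eq ?_) (integral_mono (i3.const_mul Z⁻¹) hA hpt)
  rw [integral_const_mul]
  have e3 := integral_add i2 (hγB P).1
  have e2 := integral_sub i1 hγW
  have e1 := integral_sub (hγi.const_mul (1 + inner ℝ A g + Real.log Z)) (hγB A).1
  rw [integral_const_mul, (hγB A).2, ← hZ] at e1
  rw [(hγB P).2] at e3
  simp only [Pi.add_apply, Pi.sub_apply] at e1 e2 e3 ⊢
  rw [e3, e2, e1, inner_sub_right]
  field_simp
  ring

/-- Coercivity: taking `g'` slightly displaced from `g` along `-e` makes the affine lower bound grow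
in the direction `e`. Using `e = ± b i` for an orthonormal basis bounds every coordinate of `A`. -/
theorem exists_norm_le_of_dual_le {g : SymForm N} (hg : g.toMat.PosDef) {W : State N → ℝ}
    (hWm : Measurable W) (hWexp : AtMostExpGrowth W) (c : ℝ) :
    ∃ R : ℝ, ∀ A : SymForm N,
      Integrable (fun x : State N => Real.exp (inner ℝ A g - inner ℝ A (outerSq x) - W x)) →
      ∫ x : State N, Real.exp (inner ℝ A g - inner ℝ A (outerSq x) - W x) ≤ c → ‖A‖ ≤ R := by
  obtain ⟨a, ha, hga⟩ := (SymForm.posDef_toMat_iff g).1 hg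
  set b := stdOrthonormalBasis ℝ (SymForm N) with hb
  have key : ∀ e : SymForm N, ‖e‖ = 1 → ∃ R : ℝ, ∀ A : SymForm N,
      Integrable (fun x : State N => Real.exp (inner ℝ A g - inner ℝ A (outerSq x) - W x)) →
      ∫ x : State N, Real.exp (inner ℝ A g - inner ℝ A (outerSq x) - W x) ≤ c →
      inner ℝ A e ≤ R := by
    intro e he
    -- A displacement of length `a / 2` keeps at least half of the coercivity constant of `g`.
    have hg' : (g - (a / 2) • e).toMat.PosDef := by
      refine SymForm.posDef_of_norm_sub_le ha hga (le_of_eq ?_)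
      rw [sub_sub_cancel_left, norm_neg, norm_smul, he, Real.norm_of_nonneg (by positivity), mul_one]
    obtain ⟨C, hC⟩ := exists_affine_le_dual g hWm hWexp hg'
    refine ⟨2 / a * (c - C), fun A hA hAc => ?_⟩
    have h1 := (hC A hA).trans hAc
    rw [sub_sub_cancel, real_inner_smul_right] at h1
    calc inner ℝ A e = 2 / a * (a / 2 * inner ℝ A e) := by field_simp
      _ ≤ _ := by
        gcongr
        linarith
  choose R1 hR1 using fun i => key (b i) (b.norm_eq_one i)
  choose R2 hR2 using fun i => key (-b i) (by rw [norm_neg, b.norm_eq_one i])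
  refine ⟨∑ i, max (R1 i) (R2 i), fun A hA hAc => ?_⟩
  calc ‖A‖ = ‖∑ i, inner ℝ (b i) A • b i‖ := by rw [b.sum_repr']
    _ ≤ ∑ i, ‖inner ℝ (b i) A • b i‖ := norm_sum_le _ _
    _ ≤ _ := Finset.sum_le_sum fun i _ => by
      rw [norm_smul, b.norm_eq_one i, mul_one, Real.norm_eq_abs, real_inner_comm]
      have h1 := hR1 i A hA hAc
      have h2 := hR2 i A hA hAc
      rw [inner_neg_right] at h2
      exact abs_le'.2 ⟨h1.trans (le_max_left _ _), h2.trans (le_max_right _ _)⟩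

theorem exists_isMin_dualFn {g : SymForm N} (hg : g.toMat.PosDef) {W : State N → ℝ}
    (hWm : Measurable W) (hW : ∀ x, 0 ≤ W x) (hWexp : AtMostExpGrowth W) :
    ∃ A₀ : SymForm N, dualFn g W A₀ < ⊤ ∧ ∀ A, dualFn g W A₀ ≤ dualFn g W A := by
  set A₁ := gaussParam g with hA₁
  have hA₁i : Integrable fun x : State N =>
      Real.exp (inner ℝ A₁ g - inner ℝ A₁ (outerSq x) - W x) := by
    refine ((integrable_exp_gaussParam hg).const_mul (Real.exp (inner ℝ A₁ g))).mono'
      (measurable_exp_sub hWm _ A₁).aestronglyMeasurable (Eventually.of_forall fun x => ?_)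
    rw [Real.norm_of_nonneg (Real.exp_pos _).le, ← Real.exp_add]
    exact Real.exp_le_exp.2 (by linarith [hW x])
  set c := ∫ x : State N, Real.exp (inner ℝ A₁ g - inner ℝ A₁ (outerSq x) - W x) with hc
  have hc0 : 0 ≤ c := integral_nonneg fun x => (Real.exp_pos _).le
  have hA₁c : dualFn g W A₁ = ENNReal.ofReal c := dualFn_eq hA₁i
  obtain ⟨R, hR⟩ := exists_norm_le_of_dual_le hg hWm hWexp c
  -- This sublevel set is closed by semicontinuity and bounded by coercivity, hence compact. It
  -- contains `A₁`.
  set K := dualFn g W ⁻¹' Set.Iic (ENNReal.ofReal c) with hK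
  have hlsc := lowerSemicontinuous_dualFn g hWm
  have hKlt : ∀ A ∈ K, dualFn g W A < ⊤ := fun A hA => lt_of_le_of_lt hA ENNReal.ofReal_lt_top
  have hKc : IsCompact K := by
    refine (isCompact_closedBall (0 : SymForm N) R).of_isClosed_subset (hlsc.isClosed_preimage _) ?_
    intro A hA
    have h1 := integrable_of_dualFn_lt_top hWm (hKlt A hA)
    rw [mem_closedBall_zero_iff]
    refine hR A h1 ?_
    have h2 : dualFn g W A ≤ ENNReal.ofReal c := hA
    rwa [dualFn_eq h1, ENNReal.ofReal_le_ofReal_iff hc0] at h2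
  obtain ⟨A₀, hA₀, hmin⟩ := LowerSemicontinuousOn.exists_isMinOn ⟨A₁, hA₁c.le⟩ hKc
    (hlsc.lowerSemicontinuousOn K)
  refine ⟨A₀, hKlt A₀ hA₀, fun A => ?_⟩
  by_cases hA : A ∈ K
  · exact hmin hA
  · exact le_trans hA₀ (le_of_lt (not_le.1 hA))

theorem AtMostExpGrowth.const_smul {V : State N → ℝ} (hV : AtMostExpGrowth V) {ε : ℝ} (hε : 0 < ε) :
    AtMostExpGrowth (ε • V) := by
  obtain ⟨B, C, hB, hC, h⟩ := hV
  refine ⟨ε * B, C, by positivity, hC, fun x => ?_⟩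
  rw [Pi.smul_apply, smul_eq_mul, abs_mul, abs_of_pos hε, mul_assoc]
  gcongr
  exact h x

/-- If the domain of the free energy is open, then the moment equation has a solution. -/
theorem exists_gibbs_parameter (hVm : Measurable V) (hV : ∀ x, 0 ≤ V x) (hVexp : AtMostExpGrowth V)
    {ε₀ : ℝ} (hε₀ : 0 < ε₀)
    (hopen : IsOpen {A : SymForm N |
      Integrable fun x : State N => Real.exp (-inner ℝ A (outerSq x) - (ε₀ • V) x)})
    {g : SymForm N} (hg : g.toMat.PosDef) :
    ∃ (A₀ : SymForm N) (O : Set (SymForm N × ℝ)), DominatedFamily volume outerSq (weight V) O ∧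
      (A₀, ε₀) ∈ O ∧
      ∫ x : State N, Real.exp (-inner ℝ A₀ (outerSq x) - (ε₀ • V) x) • outerSq x =
        (∫ x : State N, Real.exp (-inner ℝ A₀ (outerSq x) - (ε₀ • V) x)) • g := by
  set W := ε₀ • V with hW
  have hWm : Measurable W := hVm.const_smul ε₀
  have hW0 : ∀ x, 0 ≤ W x := fun x => mul_nonneg hε₀.le (hV x)
  have hWexp : AtMostExpGrowth W := hVexp.const_smul hε₀
  obtain ⟨A₀, hfin, hmin⟩ := exists_isMin_dualFn hg hWm hW0 hWexp
  have hshift : ∀ (A : SymForm N) (x : State N), Real.exp (inner ℝ A g - inner ℝ A (outerSq x) - W x) =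
      Real.exp (inner ℝ A g) * Real.exp (-inner ℝ A (outerSq x) - W x) := fun A x => by
    rw [← Real.exp_add]
    congr 1
    ring
  have hA₀i : Integrable fun x : State N => Real.exp (-inner ℝ A₀ (outerSq x) - W x) := by
    have h1 := (integrable_of_dualFn_lt_top hWm hfin).const_mul (Real.exp (-inner ℝ A₀ g))
    refine h1.congr (Eventually.of_forall fun x => ?_)
    simp only
    rw [← Real.exp_add]
    congr 1
    ring
  -- Openness of the domain enters here: it leaves room to lower `A₀` by a multiple of the identity,
  -- which is the slack required for domination.
  have hint : ∃ b : ℝ, 0 < b ∧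
      Integrable fun x : State N => Real.exp (-inner ℝ (A₀ - b • SymForm.one N) (outerSq x) - W x) := by
    have hcont : Tendsto (fun b : ℝ => A₀ - b • SymForm.one N) (𝓝[>] 0) (𝓝 A₀) := by
      have : Continuous fun b : ℝ => A₀ - b • SymForm.one N := by fun_prop
      have := this.tendsto 0
      simp only [zero_smul, sub_zero] at this
      exact this.mono_left nhdsWithin_le_nhds
    obtain ⟨b, hb1, hb2⟩ := ((hcont.eventually (hopen.mem_nhds hA₀i)).and self_mem_nhdsWithin).exists
    exact ⟨b, hb2, hb1⟩
  obtain ⟨b, hb, hbi⟩ := hint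
  obtain ⟨O, hO, hmem⟩ := exists_dominatedFamily_of_interior hVm hV (A₀ := A₀) hε₀ hb (by
    refine hbi.congr (Eventually.of_forall fun x => ?_)
    simp only [inner_sub_left, real_inner_smul_left, inner_one_outerSq, hW, Pi.smul_apply,
      smul_eq_mul]
    congr 1
    ring)
  refine ⟨A₀, O, hO, hmem, ?_⟩
  set Z := tiltedIntegral volume outerSq (weight V) 0 (fun _ => (1 : ℝ)) with hZ
  have hc1 : PolyGrowth (F := ℝ) volume (outerSq : State N → SymForm N) fun _ => (1 : ℝ) :=
    polyGrowth_const _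
  have hZi : ∀ A, (A, ε₀) ∈ O → Integrable fun x : State N => Real.exp (-inner ℝ A (outerSq x) - W x) :=
    fun A hA => by
      have := hO.integrable hc1 0 hA
      simpa only [weight_mul_exp hV hε₀.le, smul_eq_mul, mul_one] using this
  have hTi : Integrable fun x : State N => Real.exp (-inner ℝ A₀ (outerSq x) - W x) • outerSq x := by
    have := hO.integrable hO.polyGrowth_stat 0 hmem
    simpa only [weight_mul_exp hV hε₀.le] using this
  have hdual : ∀ A, (A, ε₀) ∈ O → dualFn g W A = ENNReal.ofReal (Real.exp (inner ℝ A g) * Z (A, ε₀)) := by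
    intro A hA
    have h1 : Integrable fun x : State N => Real.exp (inner ℝ A g - inner ℝ A (outerSq x) - W x) := by
      simp_rw [hshift]
      exact (hZi A hA).const_mul _
    rw [dualFn_eq h1, hZ, tiltedIntegral_one hV hε₀.le, ← integral_const_mul]
    simp_rw [hshift]
    rfl
  set f : SymForm N → ℝ := fun A => Real.exp (inner ℝ A g) * Z (A, ε₀) with hf
  have hlocal : IsLocalMin f A₀ := by
    have hcont : Tendsto (fun A : SymForm N => (A, ε₀)) (𝓝 A₀) (𝓝 (A₀, ε₀)) :=
      (by fun_prop : Continuous fun A : SymForm N => (A, ε₀)).tendsto A₀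
    filter_upwards [hcont.eventually (hO.isOpen.mem_nhds hmem)] with A hA
    have h1 := hmin A
    rw [hdual A hA, hdual A₀ hmem, ENNReal.ofReal_le_ofReal_iff] at h1
    · exact h1
    · rw [hZ, tiltedIntegral_one hV hε₀.le]
      exact mul_nonneg (Real.exp_pos _).le (integral_nonneg fun x => (Real.exp_pos _).le)
  have hZd := (hO.hasFDerivAt hc1 0 hmem).differentiableAt.hasFDerivAt
  have hinl : HasFDerivAt (fun A : SymForm N => (A, ε₀)) (ContinuousLinearMap.inl ℝ (SymForm N) ℝ) A₀ :=
    (hasFDerivAt_id A₀).prodMk (hasFDerivAt_const ε₀ A₀)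
  have hZd' := hZd.comp A₀ hinl
  have hexp : HasFDerivAt (fun A : SymForm N => Real.exp (inner ℝ A g))
      (Real.exp (inner ℝ A₀ g) • innerSL ℝ g) A₀ := by
    have h1 : HasFDerivAt (fun A : SymForm N => inner ℝ A g) (innerSL ℝ g) A₀ := by
      refine (innerSL ℝ g).hasFDerivAt.congr_of_eventuallyEq (Eventually.of_forall fun A => ?_)
      simp [real_inner_comm]
    exact h1.exp
  -- Stationarity of `exp ⟪A, g⟫ Z(A, ε₀)`, after division by the exponential, is the moment
  -- equation paired with an arbitrary direction.
  have hcrit := hlocal.hasFDerivAt_eq_zero (hexp.mul hZd')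
  have hZA : Z (A₀, ε₀) = ∫ x : State N, Real.exp (-inner ℝ A₀ (outerSq x) - W x) := by
    rw [hZ, tiltedIntegral_one hV hε₀.le]
  rw [← hZA, ← sub_eq_zero]
  refine ext_inner_left ℝ fun a => ?_
  have h2 := congrArg (fun L : SymForm N →L[ℝ] ℝ => L a) hcrit
  have h3 : fderiv ℝ Z (A₀, ε₀) (a, 0) =
      -inner ℝ a (∫ x : State N, Real.exp (-inner ℝ A₀ (outerSq x) - W x) • outerSq x) := by
    rw [hZ, hO.fderiv_apply_stat hc1 0 hmem, ← integral_inner hTi]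
    simp only [weight_mul_exp hV hε₀.le, smul_eq_mul, mul_one, real_inner_smul_right]
    rfl
  simp only [add_apply, smul_apply, ContinuousLinearMap.comp_apply,
    ContinuousLinearMap.inl_apply, zero_apply, smul_eq_mul, innerSL_apply_apply] at h2
  rw [inner_sub_right, real_inner_smul_right, inner_zero_right]
  have h4 : Real.exp (inner ℝ A₀ g) ≠ 0 := (Real.exp_pos _).ne'
  have h5 : Real.exp (inner ℝ A₀ g) * (inner ℝ a (∫ x : State N,
      Real.exp (-inner ℝ A₀ (outerSq x) - W x) • outerSq x) - Z (A₀, ε₀) * inner ℝ a g) = 0 := by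
    rw [real_inner_comm a g, ← hZ, h3] at h2
    linarith
  exact (mul_eq_zero.1 h5).resolve_left h4

end Minimizer

/-! ### Removing the lower bound by a quadratic shift; finiteness of `ℱ`. -/

section Shift

variable {N : ℕ} {g : SymForm N}

theorem extIntegral_add_of_integrable {μ : Measure (State N)} {f q : State N → ℝ}
    (hf : AEStronglyMeasurable f μ) (hneg : ∫⁻ x, ENNReal.ofReal (-f x) ∂μ ≠ ⊤)
    (hq : Integrable q μ) :
    extIntegral (fun x => f x + q x) μ = extIntegral f μ + ((∫ x, q x ∂μ : ℝ) : EReal) := by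
  by_cases hfi : Integrable f μ
  · rw [extIntegral_of_integrable hfi, extIntegral_of_integrable (f := fun x => f x + q x) (hfi.add hq), integral_add hfi hq,
      EReal.coe_add]
  · rw [extIntegral_eq_top_of_not_integrable hf hneg hfi,
      extIntegral_eq_top_of_not_integrable (f := fun x => f x + q x) (hf.add hq.1) ?_ ?_]
    · rfl
    · refine ne_top_of_le_ne_top ?_ (lintegral_mono (g := fun x => ENNReal.ofReal (-f x) +
        ENNReal.ofReal (-q x)) fun x => ?_)
      · rw [lintegral_add_left' (f := fun x => ENNReal.ofReal (-f x)) hf.neg.aemeasurable.ennreal_ofReal]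
        exact ENNReal.add_ne_top.2 ⟨hneg, hq.neg.lintegral_lt_top.ne⟩
      · rw [neg_add]
        exact ENNReal.ofReal_add_le
    · intro h
      exact hfi ((h.sub hq).congr (Eventually.of_forall fun x => by simp))

theorem ereal_sub_add_coe (a b : EReal) (s : ℝ) : a - (b + ((-s : ℝ) : EReal)) = a - b + s := by
  rw [sub_eq_add_neg, EReal.neg_add (Or.inr (EReal.coe_ne_top _)) (Or.inr (EReal.coe_ne_bot _)),
    EReal.coe_neg, sub_eq_add_neg (-b), neg_neg, sub_eq_add_neg, add_assoc]

/-- Adding a radial quadratic polynomial to the interaction shifts `ℱ` by a constant. -/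
theorem calF_add_quadratic {V : State N → ℝ} (hVm : Measurable V) (hV : ∀ x, 0 ≤ V x) (c : ℝ) :
    calF g.toMat (fun x => V x + -(c * (1 + ‖x‖ ^ 2))) =
      calF g.toMat V + ((c * (1 + inner ℝ (SymForm.one N) g) : ℝ) : EReal) := by
  set s : ℝ := c * (1 + inner ℝ (SymForm.one N) g) with hs
  -- The integral of `1 + ‖x‖²` equals `1 + Tr G` for every competitor, so the shift leaves the
  -- supremum.
  have key : ∀ μ ∈ momentFiber g.toMat,
      entropy μ - extIntegral (fun x => V x + -(c * (1 + ‖x‖ ^ 2))) μ =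
        entropy μ - extIntegral V μ + s := by
    intro μ hμ
    have := hμ.1
    have hq : Integrable (fun x : State N => c * (1 + ‖x‖ ^ 2)) μ :=
      ((integrable_const _).add hμ.2.1).const_mul c
    have hqint : ∫ x : State N, -(c * (1 + ‖x‖ ^ 2)) ∂μ = -s := by
      rw [integral_neg, integral_const_mul, integral_add (integrable_const _) hμ.2.1]
      simp_rw [← inner_one_outerSq]
      rw [integral_inner (integrable_outerSq hμ), integral_outerSq hμ]
      simp [hs]
    rw [extIntegral_add_of_integrable (q := fun x => -(c * (1 + ‖x‖ ^ 2)))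
      hVm.aestronglyMeasurable ?_ hq.neg]
    · rw [hqint, ereal_sub_add_coe]
    · have : ∀ x, ENNReal.ofReal (-V x) = 0 := fun x => by simp [hV x]
      simp [this]
  refine le_antisymm ?_ ?_
  · refine iSup₂_le fun μ hμ => ?_
    rw [key μ hμ]
    gcongr
    exact le_iSup₂ (f := fun μ _ => entropy μ - extIntegral V μ) μ hμ
  · rw [← EReal.le_sub_iff_add_le (Or.inl (EReal.coe_ne_bot _)) (Or.inl (EReal.coe_ne_top _))]
    refine iSup₂_le fun μ hμ => ?_
    rw [EReal.le_sub_iff_add_le (Or.inl (EReal.coe_ne_bot _)) (Or.inl (EReal.coe_ne_top _)),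
      ← key μ hμ]
    exact le_iSup₂ (f := fun μ _ => entropy μ -
      extIntegral (fun x => V x + -(c * (1 + ‖x‖ ^ 2))) μ) μ hμ

/-- The Gaussian with covariance `G` is a competitor with finite value, and the Gaussian parameter
gives the upper bound. No openness of the domain is involved, so this serves every positive
coupling. -/
theorem calF_finite_of_nonneg {V : State N → ℝ} (hVm : Measurable V) (hV : ∀ x, 0 ≤ V x)
    (hVexp : AtMostExpGrowth V) (hg : g.toMat.PosDef) :
    calF g.toMat V ≠ ⊥ ∧ calF g.toMat V ≠ ⊤ := by
  constructor
  · obtain ⟨μ, hμ, hi, hent⟩ := exists_gibbs_measure (V := 0) (g := g) measurable_zero (gaussParam g)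
      (by simpa using integrable_exp_gaussParam hg) (by simp)
      (by simpa using integrable_gauss_outerSq hg)
      (by simpa using integral_gauss_outerSq hg)
    have hVμ : Integrable V μ :=
      hi V (by simpa using integrable_gauss_mul_of_expGrowth hg hVm hVexp)
    refine ne_bot_of_le_ne_bot ?_
      (le_iSup₂ (f := fun μ _ => entropy μ - extIntegral V μ) μ hμ)
    rw [extIntegral_of_integrable hVμ, hent, ← EReal.coe_sub]
    exact EReal.coe_ne_bot _
  · refine ne_top_of_le_ne_top (EReal.coe_ne_top _) (calF_le hVm hV (gaussParam g) ?_)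
    have hTm : Measurable fun x : State N => inner ℝ (gaussParam g) (outerSq x) :=
      (continuous_const.inner continuous_outerSq).measurable
    refine (integrable_exp_gaussParam hg).mono'
      (Measurable.aestronglyMeasurable (by fun_prop)) (Eventually.of_forall fun x => ?_)
    rw [Real.norm_of_nonneg (Real.exp_pos _).le]
    exact Real.exp_le_exp.2 (by linarith [hV x])

end Shift

/-! ### From `ℱ` to the Luttinger–Ward functional and the self-energy. -/

section LocallySmooth

variable {N : ℕ}

/-- `ℱ[g, εU]` is, for nonnegative `ε`, a smooth function of `(g, ε)` near `(g₀, ε₀)`. -/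
def LocallySmooth (U : State N → ℝ) (g₀ : SymForm N) (ε₀ : ℝ) : Prop :=
  ∃ W : Set (SymForm N × ℝ), IsOpen W ∧ (g₀, ε₀) ∈ W ∧ ∃ Ψ : SymForm N × ℝ → ℝ,
    ContDiffOn ℝ ∞ Ψ W ∧ ∀ q ∈ W, 0 ≤ q.2 → calF q.1.toMat (q.2 • U) = (Ψ q : EReal)

theorem locallySmooth_zero {V : State N → ℝ} (hVm : Measurable V) (hV : ∀ x, 0 ≤ V x)
    (hVexp : AtMostExpGrowth V) {g : SymForm N} (hg : g.toMat.PosDef) : LocallySmooth V g 0 := by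
  obtain ⟨a, ha, h⟩ := gaussParam_coercive hg
  refine exists_smooth_calF hVm hV (dominatedFamily_of_posDef hVm hVexp ha h)
    (A₀ := gaussParam g) ⟨Metric.mem_ball_self (by positivity), Set.mem_univ _⟩ le_rfl ?_
  simpa using integral_gauss_outerSq hg

theorem locallySmooth_pos {V : State N → ℝ} (hVm : Measurable V) (hV : ∀ x, 0 ≤ V x)
    (hVexp : AtMostExpGrowth V) {ε₀ : ℝ} (hε₀ : 0 < ε₀)
    (hopen : IsOpen {A : SymForm N |
      Integrable fun x : State N => Real.exp (-inner ℝ A (outerSq x) - (ε₀ • V) x)})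
    {g : SymForm N} (hg : g.toMat.PosDef) : LocallySmooth V g ε₀ := by
  obtain ⟨A₀, O, hO, hmem, hmom⟩ := exists_gibbs_parameter hVm hV hVexp hε₀ hopen hg
  exact exists_smooth_calF hVm hV hO hmem hε₀.le hmom

theorem LocallySmooth.of_add_quadratic {U V : State N → ℝ} {C : ℝ} (hVm : Measurable V)
    (hV : ∀ x, 0 ≤ V x) (hUV : ∀ x, V x = U x + C * (1 + ‖x‖ ^ 2)) {g : SymForm N} {ε₀ : ℝ}
    (h : LocallySmooth V g ε₀) : LocallySmooth U g ε₀ := by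
  obtain ⟨W, hW, hmem, Ψ, hΨ, hcalF⟩ := h
  refine ⟨W, hW, hmem, fun q => Ψ q + q.2 * C * (1 + inner ℝ (SymForm.one N) q.1),
    hΨ.add ?_, fun q hq hε => ?_⟩
  · refine ContDiff.contDiffOn ?_
    exact (contDiff_snd.mul contDiff_const).mul
      (contDiff_const.add (contDiff_const.inner ℝ contDiff_fst))
  · have h1 : q.2 • U = fun x => (q.2 • V) x + -(q.2 * C * (1 + ‖x‖ ^ 2)) := by
      ext x
      simp only [Pi.smul_apply, smul_eq_mul, hUV]
      ring
    rw [h1, calF_add_quadratic (hVm.const_smul q.2) (fun x => mul_nonneg hε (hV x)), hcalF q hq hε,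
      ← EReal.coe_add]

theorem contDiff_det : ContDiff ℝ ∞ fun g : SymForm N => g.toMat.det := by
  simp only [Matrix.det_apply]
  refine ContDiff.sum fun σ _ => ContDiff.const_smul _ (contDiff_prod fun i _ => ?_)
  exact (SymForm.entry (σ i) i).contDiff

theorem LocallySmooth.exists_smooth_luttingerWard {U : State N → ℝ} {g : SymForm N} {ε₀ : ℝ}
    (h : LocallySmooth U g ε₀) (hg : g.toMat.PosDef) :
    ∃ W : Set (SymForm N × ℝ), IsOpen W ∧ (g, ε₀) ∈ W ∧ ∃ Φ : SymForm N × ℝ → ℝ,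
      ContDiffOn ℝ ∞ Φ W ∧ ∀ q ∈ W, 0 ≤ q.2 → luttingerWard q.1.toMat (q.2 • U) = Φ q := by
  obtain ⟨W, hW, hmem, Ψ, hΨ, hcalF⟩ := h
  have hdet : ContDiff ℝ ∞ fun q : SymForm N × ℝ => q.1.toMat.det := contDiff_det.comp contDiff_fst
  refine ⟨W ∩ {q | q.1.toMat.det ≠ 0}, hW.inter (isOpen_ne_fun hdet.continuous continuous_const),
    ⟨hmem, hg.det_pos.ne'⟩, fun q => 2 * Ψ q - Real.log q.1.toMat.det -
      N * Real.log (2 * Real.pi * Real.exp 1), ?_, fun q hq hε => ?_⟩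
  · refine ((contDiffOn_const.mul (hΨ.mono Set.inter_subset_left)).sub
      (hdet.contDiffOn.log fun q hq => hq.2)).sub contDiffOn_const
  · rw [luttingerWard, hcalF q hq.1 hε, EReal.toReal_coe]

theorem symUnit_isSymm (i j : Fin N) : (symUnit i j).IsSymm := by
  rw [Matrix.IsSymm, symUnit, Matrix.transpose_add, Matrix.transpose_single, Matrix.transpose_single,
    add_comm]

/-- Smooth continuations of the Luttinger–Ward functional and of the self-energy along a path of
couplings. -/
theorem LocallySmooth.exists_smooth_path {U : State N → ℝ} {G : Matrix (Fin N) (Fin N) ℝ}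
    (hG : G.PosDef) {ε₀ : ℝ} (h : LocallySmooth U (SymForm.ofMat G) ε₀) :
    ∃ I : Set ℝ, IsOpen I ∧ ε₀ ∈ I ∧ ∃ (u : ℝ → ℝ) (s : Fin N → Fin N → ℝ → ℝ),
      ContDiffOn ℝ ∞ u I ∧ (∀ i j, ContDiffOn ℝ ∞ (s i j) I) ∧ ∀ ε ∈ I, 0 ≤ ε →
        HasSelfEnergy G (ε • U) ∧ lwPath G U ε = u ε ∧ ∀ i j, sePath G U ε i j = s i j ε := by
  have hGs : G.IsSymm := by
    have := hG.isHermitian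
    rwa [Matrix.IsHermitian, Matrix.conjTranspose_eq_transpose_of_trivial] at this
  set g := SymForm.ofMat G with hg
  have hgG : g.toMat = G := SymForm.toMat_ofMat hGs
  obtain ⟨W, hW, hmem, Φ, hΦ, hlw⟩ := h.exists_smooth_luttingerWard (hgG.symm ▸ hG)
  set e : Fin N → Fin N → SymForm N := fun i j => SymForm.ofMat (symUnit i j) with he
  have heE : ∀ i j, (e i j).toMat = symUnit i j := fun i j => SymForm.toMat_ofMat (symUnit_isSymm i j)
  have hpath : ContDiff ℝ ∞ fun ε : ℝ => (g, ε) := contDiff_const.prodMk contDiff_id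
  have hmaps : Set.MapsTo (fun ε : ℝ => (g, ε)) ((fun ε : ℝ => (g, ε)) ⁻¹' W) W := fun _ h => h
  have hfd : ContDiffOn ℝ ∞ (fderiv ℝ Φ) W := hΦ.fderiv_of_isOpen hW (by simp)
  -- The coupling is frozen while the matrix moves, and joint smoothness makes the resulting partial
  -- derivative smooth in `ε`.
  have hderiv : ∀ ε, (g, ε) ∈ W → 0 ≤ ε → ∀ i j,
      HasDerivAt (fun δ : ℝ => luttingerWard (G + δ • symUnit i j) (ε • U))
        (fderiv ℝ Φ (g, ε) (e i j, 0)) 0 := by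
    intro ε hε hε0 i j
    have hline : HasDerivAt (fun δ : ℝ => (g + δ • e i j, ε)) (e i j, (0 : ℝ)) 0 := by
      refine HasDerivAt.prodMk ?_ (hasDerivAt_const _ _)
      simpa using ((hasDerivAt_id (0 : ℝ)).smul_const (e i j)).const_add g
    have hd : HasFDerivAt Φ (fderiv ℝ Φ (g, ε)) ((fun δ : ℝ => (g + δ • e i j, ε)) 0) := by
      simp only [zero_smul, add_zero]
      exact ((hΦ.contDiffAt (hW.mem_nhds hε)).differentiableAt (by simp)).hasFDerivAt
    refine (hd.comp_hasDerivAt 0 hline).congr_of_eventuallyEq ?_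
    have hnear : ∀ᶠ δ : ℝ in 𝓝 0, (g + δ • e i j, ε) ∈ W := by
      refine hline.continuousAt.eventually (hW.mem_nhds ?_)
      simpa using hε
    filter_upwards [hnear] with δ hδ
    have := hlw _ hδ hε0
    simp only [SymForm.toMat_add_smul, hgG, heE] at this
    exact this
  refine ⟨(fun ε : ℝ => (g, ε)) ⁻¹' W, hW.preimage hpath.continuous, hmem, fun ε => Φ (g, ε),
    fun i j ε => 1 / 2 * fderiv ℝ Φ (g, ε) (e i j, 0), hΦ.comp hpath.contDiffOn hmaps, fun i j => ?_,
    fun ε hε hε0 => ⟨fun i j => (hderiv ε hε hε0 i j).differentiableAt, ?_, fun i j => ?_⟩⟩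
  · exact contDiffOn_const.mul ((hfd.comp hpath.contDiffOn hmaps).clm_apply contDiffOn_const)
  · have := hlw _ hε hε0
    rwa [hgG] at this
  · rw [sePath, selfEnergy, Matrix.of_apply, (hderiv ε hε hε0 i j).deriv]

end LocallySmooth

/-! ### Taylor expansion at zero coupling. -/

section Asymptotics

/-- A function which agrees on `(0, τ)` with a function that is smooth near `0` and vanishes there
has an asymptotic Taylor series at `0⁺`. -/
theorem exists_asymptotic_series {F u : ℝ → ℝ} {I : Set ℝ} (hI : IsOpen I) (h0 : (0 : ℝ) ∈ I)
    (hu : ContDiffOn ℝ ∞ u I) (hF : ∀ ε ∈ I, 0 < ε → F ε = u ε) (hu0 : u 0 = 0) :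
    ∃ c : ℕ → ℝ, (∀ k, Tendsto (iteratedDeriv k F) (𝓝[>] 0) (𝓝 (k ! * c k))) ∧
      ∀ M : ℕ, (fun ε : ℝ => F ε - ∑ k ∈ Finset.Icc 1 M, c k * ε ^ k)
        =O[𝓝[>] 0] (fun ε : ℝ => ε ^ (M + 1)) := by
  have hInhds : ∀ᶠ ε in 𝓝[>] (0 : ℝ), ε ∈ I := nhdsWithin_le_nhds (hI.mem_nhds h0)
  refine ⟨fun k => (k ! : ℝ)⁻¹ * iteratedDeriv k u 0, fun k => ?_, fun M => ?_⟩
  · have hk : (k ! : ℝ) ≠ 0 := by positivity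
    rw [mul_inv_cancel_left₀ hk]
    have hcont : ContinuousAt (iteratedDeriv k u) 0 := by
      have h1 : ContinuousOn (iteratedDerivWithin k u I) I :=
        hu.continuousOn_iteratedDerivWithin (by exact_mod_cast le_top) hI.uniqueDiffOn
      refine (h1.continuousAt (hI.mem_nhds h0)).congr ?_
      filter_upwards [hI.mem_nhds h0] with x hx using iteratedDerivWithin_of_isOpen hI hx
    refine (hcont.mono_left nhdsWithin_le_nhds).congr' ?_
    filter_upwards [hInhds, self_mem_nhdsWithin] with ε hε hε0
    refine (Filter.EventuallyEq.iteratedDeriv_eq k ?_).symm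
    filter_upwards [hI.mem_nhds hε, lt_mem_nhds (Set.mem_Ioi.1 hε0)] with x hx hx0 using hF x hx hx0
  · obtain ⟨r, hr, hball⟩ := Metric.isOpen_iff.1 hI 0 h0
    set b := r / 2 with hb
    have hb0 : 0 < b := half_pos hr
    have hsub : Set.Icc 0 b ⊆ I := fun x hx => hball <| by
      rw [Metric.mem_ball, dist_zero_right, Real.norm_of_nonneg hx.1]
      linarith [hx.2]
    obtain ⟨C, hC⟩ := exists_taylor_mean_remainder_bound (n := M) hb0.le
      ((hu.mono hsub).of_le (by exact_mod_cast le_top))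
    refine IsBigO.of_bound C ?_
    filter_upwards [Ioo_mem_nhdsGT hb0] with ε hε
    have h1 := hC ε ⟨hε.1.le, hε.2.le⟩
    -- The term of index zero is split off. It vanishes because `u 0 = 0`, which leaves the sum from
    -- `1` to `M`.
    rw [taylor_within_apply, Finset.range_eq_Ico, Finset.sum_eq_sum_Ico_succ_bot (by omega)] at h1
    have hit : ∀ k, iteratedDerivWithin k u (Set.Icc 0 b) 0 = iteratedDeriv k u 0 := fun k =>
      iteratedDerivWithin_eq_iteratedDeriv (uniqueDiffOn_Icc hb0)
        ((hu.contDiffAt (hI.mem_nhds h0)).of_le (by exact_mod_cast le_top)) ⟨le_rfl, hb0.le⟩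
    simp only [hit, iteratedDeriv_zero, hu0, smul_eq_mul, mul_zero, zero_add, sub_zero] at h1
    rw [hF ε (hsub ⟨hε.1.le, hε.2.le⟩) hε.1, Real.norm_of_nonneg (pow_nonneg hε.1.le (M + 1))]
    refine le_trans (le_of_eq ?_) h1
    congr 2
    have : Finset.Icc 1 M = Finset.Ico 1 (M + 1) := by
      ext k
      simp only [Finset.mem_Icc, Finset.mem_Ico]
      omega
    rw [this]
    exact Finset.sum_congr rfl fun k _ => by ring

end Asymptotics

/-! ### Translation to the original data `U` and `G`. -/

section Main

variable {N : ℕ}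

theorem atMostExpGrowth_add_quadratic {U : State N → ℝ} (hU : AtMostExpGrowth U) (C : ℝ) :
    AtMostExpGrowth fun x => U x + C * (1 + ‖x‖ ^ 2) := by
  obtain ⟨B, c, hB, hc, h⟩ := hU
  refine ⟨B + 2 * |C|, c + 1, by positivity, by positivity, fun x => ?_⟩
  have h1 : 1 + ‖x‖ ^ 2 ≤ 2 * Real.exp ‖x‖ := by
    have := Real.quadratic_le_exp_of_nonneg (norm_nonneg x)
    nlinarith [norm_nonneg x]
  calc |U x + C * (1 + ‖x‖ ^ 2)| ≤ |U x| + |C * (1 + ‖x‖ ^ 2)| := abs_add_le _ _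
    _ ≤ B * Real.exp (c * ‖x‖) + |C| * (2 * Real.exp ‖x‖) := by
        rw [abs_mul, abs_of_nonneg (show 0 ≤ 1 + ‖x‖ ^ 2 by positivity)]
        gcongr
        exact h x
    _ ≤ B * Real.exp ((c + 1) * ‖x‖) + |C| * (2 * Real.exp ((c + 1) * ‖x‖)) := by
        have := norm_nonneg x
        gcongr
        · linarith
        · nlinarith
    _ = _ := by ring

/-- The two conventions, `½ xᵀAx` with `U` and `⟪A, xxᵀ⟫` with `V`, differ by the affine change `A ↦
2 (A + εC • 1)`. It carries openness of `domOmega` over to the integrability set. -/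
theorem integrable_exp_iff_mem_domOmega {U V : State N → ℝ} {C ε : ℝ} (hUm : Measurable U)
    (hUV : ∀ x, V x = U x + C * (1 + ‖x‖ ^ 2)) (A : SymForm N) :
    (Integrable fun x : State N => Real.exp (-inner ℝ A (outerSq x) - (ε • V) x)) ↔
      (⟨((2 : ℝ) • (A + (ε * C) • SymForm.one N)).toMat, SymForm.toMat_isSymm _⟩ : SymMat N) ∈
        domOmega (ε • U) := by
  set B := (2 : ℝ) • (A + (ε * C) • SymForm.one N) with hB
  have hpt : ∀ x : State N, Real.exp (-inner ℝ A (outerSq x) - (ε • V) x) =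
      Real.exp (-(ε * C)) * Real.exp (-(1 / 2) * quadForm B.toMat x - (ε • U) x) := fun x => by
    rw [← inner_outerSq, hB, ← Real.exp_add, real_inner_smul_left, inner_add_left,
      real_inner_smul_left, inner_one_outerSq, Pi.smul_apply, Pi.smul_apply, smul_eq_mul,
      smul_eq_mul, hUV]
    congr 1
    ring
  have hq : Measurable fun x : State N => quadForm B.toMat x := by
    simp_rw [← inner_outerSq]
    exact (continuous_const.inner continuous_outerSq).measurable
  have hm : Measurable fun x : State N =>
      Real.exp (-(1 / 2) * quadForm B.toMat x - (ε • U) x) :=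
    ((hq.const_mul _).sub (hUm.const_smul ε)).exp
  simp_rw [hpt]
  rw [integrable_const_mul_iff (Real.exp_pos _).ne'.isUnit]
  simp only [domOmega, partitionFn, Set.mem_ofPred_eq]
  constructor
  · intro h
    exact h.lintegral_lt_top
  · intro h
    refine ⟨hm.aestronglyMeasurable, ?_⟩
    rw [hasFiniteIntegral_iff_norm]
    simpa only [Real.norm_of_nonneg (Real.exp_pos _).le] using h

theorem isOpen_integrable_exp {U V : State N → ℝ} {C ε : ℝ} (hUm : Measurable U)
    (hUV : ∀ x, V x = U x + C * (1 + ‖x‖ ^ 2)) (hopen : IsOpen (domOmega (ε • U))) :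
    IsOpen {A : SymForm N |
      Integrable fun x : State N => Real.exp (-inner ℝ A (outerSq x) - (ε • V) x)} := by
  simp_rw [integrable_exp_iff_mem_domOmega hUm hUV]
  refine hopen.preimage (f := fun A : SymForm N =>
    (⟨((2 : ℝ) • (A + (ε * C) • SymForm.one N)).toMat, SymForm.toMat_isSymm _⟩ : SymMat N)) ?_
  exact (SymForm.continuous_toMat.comp (by fun_prop)).subtype_mk _

theorem sePath_zero {U : State N → ℝ} {G : Matrix (Fin N) (Fin N) ℝ} (hG : G.PosDef) (i j : Fin N) :
    sePath G U 0 i j = 0 := by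
  have hGs : G.IsSymm := by
    have := hG.isHermitian
    rwa [Matrix.IsHermitian, Matrix.conjTranspose_eq_transpose_of_trivial] at this
  have hgG : (SymForm.ofMat G).toMat = G := SymForm.toMat_ofMat hGs
  have hev := SymForm.eventually_posDef (g := SymForm.ofMat G) (hgG.symm ▸ hG)
  have hline : Tendsto (fun δ : ℝ => SymForm.ofMat G + δ • SymForm.ofMat (symUnit i j)) (𝓝 0)
      (𝓝 (SymForm.ofMat G)) := by
    have : Continuous fun δ : ℝ => SymForm.ofMat G + δ • SymForm.ofMat (symUnit i j) := by fun_prop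
    simpa using this.tendsto 0
  -- Positive definiteness persists for small `δ`, so `Φ[·, 0]` vanishes along the whole segment and
  -- its derivative is zero.
  have hz : (fun δ : ℝ => luttingerWard (G + δ • symUnit i j) (0 : State N → ℝ)) =ᶠ[𝓝 0]
      fun _ => 0 := by
    filter_upwards [hline.eventually hev] with δ hδ
    have := luttingerWard_zero hδ
    rwa [SymForm.toMat_add_smul, hgG, SymForm.toMat_ofMat (symUnit_isSymm i j)] at this
  rw [sePath, selfEnergy, Matrix.of_apply, zero_smul, hz.deriv_eq]
  simp

end Main

end GibbsLW

end

open GibbsLW in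
theorem proposition4p3 (N : ℕ) (U : GibbsLW.State N → ℝ)
    (hUcont : Continuous U) (hUweak : GibbsLW.WeakGrowth U) (hUexp : GibbsLW.AtMostExpGrowth U)
    (G : Matrix (Fin N) (Fin N) ℝ) (hG : G.PosDef) :
    -- `ℱ[G,εU]` is finite, so that `Φ_G(ε)` is a well-defined real number
    (∀ ε : ℝ, 0 < ε → GibbsLW.calF G (ε • U) ≠ ⊥ ∧ GibbsLW.calF G (ε • U) ≠ ⊤) ∧
    -- smoothness at every positive coupling at which the formalism applies to `ε₀U`
    (∀ ε₀ : ℝ, 0 < ε₀ → GibbsLW.WeakGrowth (ε₀ • U) →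
      GibbsLW.HasSelfEnergy G (ε₀ • U) ∧
      ContDiffAt ℝ ∞ (GibbsLW.lwPath G U) ε₀ ∧
      ∀ i j, ContDiffAt ℝ ∞ (fun ε => GibbsLW.sePath G U ε i j) ε₀) ∧
    -- smoothness on some `(0,τ)`, without further conditions
    (∃ τ : ℝ, 0 < τ ∧
      (∀ ε ∈ Set.Ioo 0 τ, GibbsLW.HasSelfEnergy G (ε • U)) ∧
      ContDiffOn ℝ ∞ (GibbsLW.lwPath G U) (Set.Ioo 0 τ) ∧
      ∀ i j, ContDiffOn ℝ ∞ (fun ε => GibbsLW.sePath G U ε i j) (Set.Ioo 0 τ)) ∧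
    ∃ (Φc : ℕ → ℝ) (Sc : ℕ → Matrix (Fin N) (Fin N) ℝ),
      -- all derivatives extend continuously to `0`; the extensions at `0` define the coefficients
      (∀ k, Tendsto (iteratedDeriv k (GibbsLW.lwPath G U)) (𝓝[>] 0) (𝓝 (k ! * Φc k))) ∧
      (∀ k i j, Tendsto (iteratedDeriv k (fun ε => GibbsLW.sePath G U ε i j)) (𝓝[>] 0)
        (𝓝 (k ! * Sc k i j))) ∧
      -- the series are asymptotic, and have no term of order zero
      ∀ M : ℕ,
        (fun ε : ℝ => GibbsLW.lwPath G U ε - ∑ k ∈ Finset.Icc 1 M, Φc k * ε ^ k)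
          =O[𝓝[>] 0] (fun ε : ℝ => ε ^ (M + 1)) ∧
        ∀ i j, (fun ε : ℝ => GibbsLW.sePath G U ε i j - ∑ k ∈ Finset.Icc 1 M, Sc k i j * ε ^ k)
          =O[𝓝[>] 0] (fun ε : ℝ => ε ^ (M + 1)) := by

  obtain ⟨C, hC⟩ := hUweak.lower_bound
  set V : State N → ℝ := fun x => U x + C * (1 + ‖x‖ ^ 2) with hV
  have hUV : ∀ x, V x = U x + C * (1 + ‖x‖ ^ 2) := fun x => rfl
  have hVm : Measurable V := Continuous.measurable (by fun_prop)
  have hVexp : AtMostExpGrowth V := atMostExpGrowth_add_quadratic hUexp C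
  have hGs : G.IsSymm := by
    have := hG.isHermitian
    rwa [Matrix.IsHermitian, Matrix.conjTranspose_eq_transpose_of_trivial] at this
  have hgG : (SymForm.ofMat G).toMat = G := SymForm.toMat_ofMat hGs
  have hg : (SymForm.ofMat G).toMat.PosDef := hgG.symm ▸ hG
  -- The continuation at zero coupling requires no openness of the domain of `εU`. It supplies both
  -- the interval `(0, τ)` and the expansions.
  obtain ⟨I, hI, h0I, u, s, hu, hs, hpath⟩ :=
    ((locallySmooth_zero hVm hC hVexp hg).of_add_quadratic hVm hC hUV).exists_smooth_path hG
  refine ⟨fun ε hε => ?_, fun ε₀ hε₀ hweak => ?_, ?_, ?_⟩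
  · have h1 : ε • U = fun x => (ε • V) x + -(ε * C * (1 + ‖x‖ ^ 2)) := by
      ext x
      simp only [Pi.smul_apply, smul_eq_mul, hUV]
      ring
    have h2 := calF_add_quadratic (g := SymForm.ofMat G) (hVm.const_smul ε)
      (fun x => mul_nonneg hε.le (hC x)) (ε * C)
    rw [← h1, hgG] at h2
    obtain ⟨h3, h4⟩ := calF_finite_of_nonneg (hVm.const_smul ε)
      (fun x => mul_nonneg hε.le (hC x)) (hVexp.const_smul hε) hg
    rw [hgG] at h3 h4
    lift calF G (ε • V) to ℝ using ⟨h4, h3⟩ with r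
    rw [h2, ← EReal.coe_add]
    exact ⟨EReal.coe_ne_bot _, EReal.coe_ne_top _⟩
  · obtain ⟨I, hI, hεI, u, s, hu, hs, hpath⟩ := ((locallySmooth_pos hVm hC hVexp hε₀
      (isOpen_integrable_exp hUcont.measurable hUV hweak.isOpen_dom) hg).of_add_quadratic
        hVm hC hUV).exists_smooth_path hG
    -- The smooth continuations represent the true functions only for `ε ≥ 0`, which holds near `ε₀
    -- > 0`.
    have hnear : ∀ᶠ ε in 𝓝 ε₀, ε ∈ I ∧ 0 ≤ ε :=
      Filter.Eventually.and (hI.mem_nhds hεI) ((lt_mem_nhds hε₀).mono fun _ h => le_of_lt h)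
    refine ⟨(hpath ε₀ hεI hε₀.le).1, (hu.contDiffAt (hI.mem_nhds hεI)).congr_of_eventuallyEq ?_,
      fun i j => ((hs i j).contDiffAt (hI.mem_nhds hεI)).congr_of_eventuallyEq ?_⟩
    · filter_upwards [hnear] with ε hε using (hpath ε hε.1 hε.2).2.1
    · filter_upwards [hnear] with ε hε using (hpath ε hε.1 hε.2).2.2 i j
  · obtain ⟨τ, hτ, hball⟩ := Metric.isOpen_iff.1 hI 0 h0I
    have hsub : Set.Ioo 0 τ ⊆ I := fun ε hε => hball <| by
      rw [Metric.mem_ball, dist_zero_right, Real.norm_of_nonneg hε.1.le]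
      exact hε.2
    exact ⟨τ, hτ, fun ε hε => (hpath ε (hsub hε) hε.1.le).1,
      (hu.mono hsub).congr fun ε hε => (hpath ε (hsub hε) hε.1.le).2.1,
      fun i j => ((hs i j).mono hsub).congr fun ε hε => (hpath ε (hsub hε) hε.1.le).2.2 i j⟩
  · have hu0 : u 0 = 0 := by
      rw [← (hpath 0 h0I le_rfl).2.1, lwPath, zero_smul, ← hgG, luttingerWard_zero hg]
    have hs0 : ∀ i j, s i j 0 = 0 := fun i j => by
      rw [← (hpath 0 h0I le_rfl).2.2 i j, sePath_zero hG]
    obtain ⟨Pc, hP1, hP2⟩ := exists_asymptotic_series hI h0I hu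
      (fun ε hε hε0 => (hpath ε hε hε0.le).2.1) hu0
    choose Sc hS1 hS2 using fun i j => exists_asymptotic_series hI h0I (hs i j)
      (fun ε hε hε0 => (hpath ε hε hε0.le).2.2 i j) (hs0 i j)
    exact ⟨Pc, fun k => Matrix.of fun i j => Sc i j k, hP1, fun k i j => hS1 i j k,
      fun M => ⟨hP2 M, fun i j => hS2 i j M⟩⟩
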